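/- Let $\nu>0$. For $\alpha\in(0,1)$, $\beta\in(2\alpha,\alpha+1]$ and $\epsilon>0$ consider on $\mathbb R^2$ the equation $$\partial_t\theta+u\cdot\nabla\theta+\nu\Lambda^\beta\theta-\epsilon\Delta\theta=0,\qquad u=\Lambda^\alpha\mathcal R^{\perp}\theta,\qquad \theta(0,x)=\theta_0(x),$$ where $\Lambda^s=(-\Delta)^{s/2}$ is the Fourier multiplier with symbol $|\zeta|^s$ and $\mathcal R^\perp=(-\mathcal R_2,\mathcal R_1)$ with $\mathcal R_j$ the Riesz transforms (symbol $-i\zeta_j/|\zeta|$). For $\gamma\in(0,1)$, $H,\delta>0$ and $0<\xi_0\le\delta$ set $$\omega(\xi,\xi_0)=\begin{cases}\gamma H\delta^{-\gamma}\xi_0^{\gamma-1}\xi+(1-\gamma)H\delta^{-\gamma}\xi_0^{\gamma},&0<\xi\le\xi_0,\\ H\delta^{-\gamma}\xi^\gamma,&\xi_0<\xi\le\delta,\\ H,&\xi>\delta.\end{cases}$$ A function $f:\mathbb R^2\to\mathbb R$ is said to obey $\omega(\cdot,\xi_0)$ if $|f(x)-f(y)|<\omega(|x-y|,\xi_0)$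 for all $x\ne y$. Lemma 5.4. Let $\nu>0$, $\alpha\in(0,1)$, $\beta\in(2\alpha,\alpha+1]$ and $\gamma\in(\max\{\alpha+1-\beta,\alpha/2\},1)$. There exist constants $C_1=C_1(\alpha,\beta,\gamma,\nu)>0$ and $C_2=C_2(\beta,\gamma,\nu)>0$ such that the following holds for all $\epsilon>0$, $m>2$, $c_1\in(0,1/2]$, $H,\delta>0$ and all $\theta_0\in H^m(\mathbb R^2)$ (represented by its continuous version). Let $\theta\in C([0,\infty);H^m)\cap C^\infty((0,\infty)\times\mathbb R^2)$ be a global smooth solution of the equation above with initial data $\theta_0$. Suppose that $H\ge 2(1+c_1)\|\theta_0\|_{L^\infty}$, that $\theta_0$ obeys $\omega(\cdot,\delta)$, and that $H\le C_1\delta^{\alpha+1-\beta}$. Let $\xi_0(t)$ be the (positive) solution of $$\frac{d}{dt}\xi_0(t)=-C_2\,\xi_0(t)^{1-\beta},\qquad \xi_0(0)=\delta .$$ Then $\theta(t,\cdot)$ obeys $\omega(\cdot,\xi_0(t))$ for all $t\ge0$ up to which $\xi_0$ stays positive. In particular, $C_1$ and $C_2$ do not depend on $\epsilon$. -/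

import Mathlib

open MeasureTheory Set Filter Topology
open scoped ENNReal FourierTransform

noncomputable section

/-- The plane `ℝ²` with its Euclidean norm and Lebesgue measure. -/
abbrev Plane : Type := EuclideanSpace ℝ (Fin 2)

open Classical in
/-- The (Plancherel) Fourier transform of a real-valued `L²` function on the plane, in Mathlib's
normalization `∫ exp (-2πi x·ζ) f x dx`. It is only used for functions in `L²`. -/
def fourierL2 (f : Plane → ℝ) : Plane → ℂ :=
  if h : MemLp (fun x => (f x : ℂ)) 2 volume then
    ((𝓕 (h.toLp (fun x => (f x : ℂ))) : Lp (α := Plane) ℂ 2 volume) : Plane → ℂ)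
  else 0

/-- The `H^s` norm on `L²` functions. The factor `2π` translates Mathlib's frequency variable into
that of the transform `∫ exp (-i x·ζ) f x dx`; the norm is the usual one up to the
constant factor `2π`. -/
def sobolevNorm (s : ℝ) (f : Plane → ℝ) : ℝ≥0∞ :=
  (∫⁻ ζ : Plane,
    ENNReal.ofReal ((1 + ‖(2 * Real.pi) • ζ‖ ^ 2) ^ s) * ‖fourierL2 f ζ‖ₑ ^ 2) ^ (1 / 2 : ℝ)

/-- Membership in `H^s(ℝ²)`, for `s ≥ 0` (so that `H^s ⊆ L²`). -/
def MemH (s : ℝ) (f : Plane → ℝ) : Prop :=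
  MemLp f 2 volume ∧ sobolevNorm s f < ∞

/-- `g = σ(D) f` in `L²`: both functions are in `L²` and `ĝ(ζ) = σ(ζ) f̂(ζ)` for almost every `ζ`,
where the symbol `σ` is written in the frequency variable of `∫ exp (-i x·ζ) f x dx`. -/
def IsFourierMultiplier (σ : Plane → ℂ) (f g : Plane → ℝ) : Prop :=
  MemLp f 2 volume ∧ MemLp g 2 volume ∧
    ∀ᵐ ζ : Plane, fourierL2 g ζ = σ ((2 * Real.pi) • ζ) * fourierL2 f ζ

/-- The symbol `|ζ|^s` of `Λ^s = (-Δ)^{s/2}`. -/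
def lambdaSymbol (s : ℝ) (ζ : Plane) : ℂ := ((‖ζ‖ ^ s : ℝ) : ℂ)

/-- The symbol `-i ζ_j / |ζ|` of the `j`-th Riesz transform, that is, of the singular integral
operator with kernel `(2π)⁻¹ x_j / |x|³`. The index `0 : Fin 2` is the first coordinate. -/
def rieszSymbol (j : Fin 2) (ζ : Plane) : ℂ := -Complex.I * ((ζ j / ‖ζ‖ : ℝ) : ℂ)

/-- `u = Λ^α R^⊥ f`, where `R^⊥ = (-R₂, R₁)`. -/
def IsVelocity (α : ℝ) (f : Plane → ℝ) (u : Plane → Plane) : Prop :=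
  IsFourierMultiplier (fun ζ => lambdaSymbol α ζ * -rieszSymbol 1 ζ) f (fun x => u x 0) ∧
  IsFourierMultiplier (fun ζ => lambdaSymbol α ζ * rieszSymbol 0 ζ) f (fun x => u x 1)

/-- `θ` is a global smooth solution of
`∂ₜθ + u·∇θ + ν Λ^β θ - ε Δθ = 0`, `u = Λ^α R^⊥ θ`, `θ(0,·) = θ₀`, of class
`C([0,∞); H^m) ∩ C^∞((0,∞) × ℝ²)`. (Only the values `θ t` with `t ≥ 0` matter.) -/
structure IsGlobalSmoothSolution (α β ν ε m : ℝ) (θ₀ : Plane → ℝ) (θ : ℝ → Plane → ℝ) :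
    Prop where
  initial : θ 0 = θ₀
  memH : ∀ t, 0 ≤ t → MemH m (θ t)
  continuous_memH : ∀ t, 0 ≤ t →
    Tendsto (fun s => sobolevNorm m (θ s - θ t)) (𝓝[Ici 0] t) (𝓝 0)
  smooth : ContDiffOn ℝ (⊤ : ℕ∞) (fun p : ℝ × Plane => θ p.1 p.2) (Ioi 0 ×ˢ univ)
  equation : ∀ t, 0 < t → ∃ (u : Plane → Plane) (v : Plane → ℝ),
    IsVelocity α (θ t) u ∧ IsFourierMultiplier (lambdaSymbol β) (θ t) v ∧
    ∀ᵐ x : Plane,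
      deriv (fun s => θ s x) t + inner ℝ (u x) (gradient (θ t) x) + ν * v x
        - ε * Laplacian.laplacian (θ t) x = 0

/-- `f` obeys the modulus of continuity `w`. -/
def ObeysModulus (f : Plane → ℝ) (w : ℝ → ℝ) : Prop :=
  ∀ x y : Plane, x ≠ y → |f x - f y| < w ‖x - y‖

/-- The modulus `ω(ξ, ξ₀)`, for `ξ > 0` and `0 < ξ₀ ≤ δ`: the function
`H (ξ/δ)^γ` on `(ξ₀, δ]`, continued by its tangent line at `ξ₀` on `(0, ξ₀]`, and by the
constant `H` on `(δ, ∞)`. -/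
def evtModulus (γ H δ ξ₀ ξ : ℝ) : ℝ :=
  if ξ ≤ ξ₀ then
    γ * H * δ ^ (-γ) * ξ₀ ^ (γ - 1) * ξ + (1 - γ) * H * δ ^ (-γ) * ξ₀ ^ γ
  else if ξ ≤ δ then H / δ ^ γ * ξ ^ γ
  else H

end

/-! ### The kernels `|η| ^ (-2 - s)` on the plane -/

/-! The proof looks at the first time at which the strict inequality fails. The maximum principle
(`abs_le_of_initial_le`) excludes pairs at distance at least `δ`, the positive intercept of the
modulus excludes the diagonal, and decay at infinity keeps the relevant pairs in a compact set. So
failure produces points `x ≠ y`, at distance `ξ ≤ δ`, where the increment equals the modulus and the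
gap is maximal in space. It suffices that the left time derivative of the gap is negative there
(`neg_of_first_touching`).

With `A = H δ^(-γ)` and `r = max ξ ξ₀`, the modulus lies below `A` times the tangent line of `s^γ`
at `r` and equals it at `ξ`. Thus all increments of `θ t` lie below an affine function `a + L|x' -
y'|`, with equality at `(x, y)`, and only this comparison is used. It forces equal gradients at `x`
and `y`, of size at most `L`, and an `ε`-Laplacian term of favourable sign, hence constants free of
`ε`. Let `G(η)` be the difference of the symmetric second differences at `x` and `y`. Then `G ≥ 0`,
and the dissipation is a multiple of `D = ∫ G(η)|η|^(-2-β)`.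

Two facts carry the estimate. First, `G(η) + G(η + x - y) ≥ a`, so `D` is at least a constant times
`ξ^(-β) a` (`integral_gap_ge_of_touching`). Second, the difference of the centered differences in
the velocity integrals is at most `2G(η)`, so the near field of the velocity increment is bounded by
`ξ^(β-α) D`; the far field is bounded by the modulus and hence, through the first fact, also by `D`
(`abs_rieszIntegral_sub_le_of_touching`). The nonlinear term is therefore at most a constant times
`L ξ^(β-α) D`, and `H ≤ C₁ δ^(α+1-β)` lets half of the dissipation absorb it
(`deriv_sub_deriv_le_of_touching`). The other half beats the decrease of the modulus in time when
`C₂` is small.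

These comparisons need the equation at every point, with the nonlocal operators as singular
integrals; `pointwise_equation` derives this from the almost-everywhere Fourier formulation. -/

theorem integrable_min_one_rpow_norm {s p : ℝ} (hs : 0 < s) (hsp : s < p) :
    Integrable (fun η : Plane => min 1 (‖η‖ ^ p) * ‖η‖ ^ (-2 - s)) := by
  refine (integrable_fun_norm_addHaar (volume : Measure Plane)
    (f := fun r : ℝ => min 1 (r ^ p) * r ^ (-2 - s))).2 ?_
  have hd : Module.finrank ℝ Plane = 2 := by simp
  have hmeas : Measurable (fun y : ℝ => y ^ (Module.finrank ℝ Plane - 1) •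
      (min 1 (y ^ p) * y ^ (-2 - s))) := by fun_prop
  rw [← Ioc_union_Ioi_eq_Ioi (zero_le_one' ℝ)]
  refine IntegrableOn.union ?_ ?_
  · have h1 : IntegrableOn (fun y : ℝ => y ^ (p - 1 - s)) (Ioc 0 1) :=
      (intervalIntegral.intervalIntegrable_rpow' (a := 0) (b := 1) (by linarith)).1
    refine h1.mono' hmeas.aestronglyMeasurable ?_
    refine (ae_restrict_iff' measurableSet_Ioc).2 (Eventually.of_forall fun y hy => ?_)
    have hy0 : 0 < y := hy.1
    rw [hd, Real.norm_of_nonneg (by have := hy0.le; positivity)]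
    have h2 : y ^ (p - 1 - s) = y ^ (2 - 1) * (y ^ p * y ^ (-2 - s)) := by
      rw [← Real.rpow_add hy0, ← Real.rpow_natCast, ← Real.rpow_add hy0]
      norm_num
      ring_nf
    rw [h2, smul_eq_mul]
    gcongr
    exact min_le_right _ _
  · have h1 : IntegrableOn (fun y : ℝ => y ^ (-1 - s)) (Ioi 1) :=
      integrableOn_Ioi_rpow_of_lt (by linarith) one_pos
    refine h1.mono' hmeas.aestronglyMeasurable ?_
    refine (ae_restrict_iff' measurableSet_Ioi).2 (Eventually.of_forall fun y hy => ?_)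
    have hy0 : 0 < y := one_pos.trans hy
    rw [hd, Real.norm_of_nonneg (by have := hy0.le; positivity)]
    have h2 : y ^ (-1 - s) = y ^ (2 - 1) * (1 * y ^ (-2 - s)) := by
      rw [one_mul, ← Real.rpow_natCast, ← Real.rpow_add hy0]
      norm_num
      ring_nf
    rw [h2, smul_eq_mul]
    gcongr
    exact min_le_left _ _

/-- The constant `C_s = ∫ (1 - cos η₀) |η| ^ (-2 - s) dη`. -/
noncomputable def fracConst (s : ℝ) : ℝ := ∫ η : Plane, (1 - Real.cos (η 0)) * ‖η‖ ^ (-2 - s)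

theorem one_sub_cos_le_min (ζ η : Plane) :
    1 - Real.cos (inner ℝ ζ η) ≤ 2 * (1 + ‖ζ‖ ^ 2) * min 1 (‖η‖ ^ (2 : ℝ)) := by
  have h1 := Real.neg_one_le_cos (inner ℝ ζ η)
  have h2 := Real.one_sub_sq_div_two_le_cos (x := inner ℝ ζ η)
  have h3 : (inner ℝ ζ η : ℝ) ^ 2 ≤ ‖ζ‖ ^ 2 * ‖η‖ ^ 2 := by
    rw [← mul_pow, ← sq_abs]
    gcongr
    exact abs_real_inner_le_norm ζ η
  rw [Real.rpow_two]
  rcases le_total 1 (‖η‖ ^ 2) with h | h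
  · rw [min_eq_left h]; nlinarith [sq_nonneg ‖ζ‖]
  · rw [min_eq_right h]; nlinarith [sq_nonneg ‖ζ‖, sq_nonneg ‖η‖]

theorem integrable_one_sub_cos_mul {s : ℝ} (hs : 0 < s) (hs2 : s < 2) (ζ : Plane) :
    Integrable (fun η : Plane => (1 - Real.cos (inner ℝ ζ η)) * ‖η‖ ^ (-2 - s)) := by
  refine ((integrable_min_one_rpow_norm hs hs2).const_mul (2 * (1 + ‖ζ‖ ^ 2))).mono'
    (by fun_prop) (Eventually.of_forall fun η => ?_)
  have := Real.cos_le_one (inner ℝ ζ η)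
  rw [Real.norm_of_nonneg (mul_nonneg (by linarith) (by positivity)), ← mul_assoc]
  gcongr
  exact one_sub_cos_le_min ζ η

theorem inner_single_zero (η : Plane) : inner ℝ (EuclideanSpace.single 0 (1 : ℝ) : Plane) η = η 0 := by
  simp [EuclideanSpace.inner_single_left]

theorem fracConst_pos {s : ℝ} (hs : 0 < s) (hs2 : s < 2) : 0 < fracConst s := by
  have hint := integrable_one_sub_cos_mul hs hs2 (EuclideanSpace.single 0 1)
  simp only [inner_single_zero] at hint
  rw [fracConst, integral_pos_iff_support_of_nonneg _ hint]
  · have ho : IsOpen {η : Plane | 0 < η 0 ∧ η 0 < 1} :=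
      isOpen_Ioo.preimage (f := fun η : Plane => η 0) (by fun_prop)
    refine (ho.measure_pos volume ⟨EuclideanSpace.single 0 (1 / 2), ?_⟩).trans_le
      (measure_mono fun η hη => ?_)
    · simp; norm_num
    · have h0 : η ≠ 0 := by rintro rfl; simpa using hη.1
      have h1 : Real.cos (η 0) ≠ 1 := by
        rw [Ne, Real.cos_eq_one_iff_of_lt_of_lt] <;> linarith [hη.1, hη.2, Real.pi_gt_three]
      exact mul_ne_zero (sub_ne_zero.2 h1.symm) (Real.rpow_pos_of_pos (norm_pos_iff.2 h0) _).ne'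
  · intro η
    have := Real.cos_le_one (η 0)
    exact mul_nonneg (by linarith) (by positivity)

/-- An isometry moves `ζ` onto the first axis, and the dilation `η ↦ ‖ζ‖ η` then produces the power.
-/
theorem integral_one_sub_cos_inner {s : ℝ} (hs : 0 < s) (ζ : Plane) :
    ∫ η : Plane, (1 - Real.cos (inner ℝ ζ η)) * ‖η‖ ^ (-2 - s) = fracConst s * ‖ζ‖ ^ s := by
  rcases eq_or_ne ζ 0 with rfl | hζ
  · simp [hs.ne']
  set r := ‖ζ‖
  have hr : 0 < r := norm_pos_iff.2 hζ
  set e : Plane := EuclideanSpace.single 0 1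
  have hn : ‖ζ‖ = ‖r • e‖ := by simp [e, r, norm_smul]
  set R := (ℝ ∙ (ζ - r • e))ᗮ.reflection
  have hR : R ζ = r • e := Submodule.reflection_sub hn
  have h1 : ∫ η : Plane, (1 - Real.cos (inner ℝ ζ η)) * ‖η‖ ^ (-2 - s)
      = ∫ η : Plane, (1 - Real.cos (inner ℝ ζ (R η))) * ‖R η‖ ^ (-2 - s) :=
    (R.measurePreserving.integral_comp R.toHomeomorph.measurableEmbedding
      (fun η => (1 - Real.cos (inner ℝ ζ η)) * ‖η‖ ^ (-2 - s))).symm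
  have h2 (η : Plane) : inner ℝ ζ (R η) = r * η 0 := by
    have : inner ℝ (R ζ) (R (R η)) = inner ℝ ζ (R η) := R.inner_map_map _ _
    rw [← this, hR, Submodule.reflection_reflection, real_inner_smul_left, inner_single_zero]
  have h3 := Measure.integral_comp_smul (volume : Measure Plane)
    (fun η : Plane => (1 - Real.cos (η 0)) * ‖η‖ ^ (-2 - s)) r
  have h4 (η : Plane) : (1 - Real.cos ((r • η) 0)) * ‖r • η‖ ^ (-2 - s) =
      r ^ (-2 - s) * ((1 - Real.cos (r * η 0)) * ‖η‖ ^ (-2 - s)) := by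
    rw [norm_smul, Real.norm_of_nonneg hr.le, Real.mul_rpow hr.le (norm_nonneg _)]
    simp only [PiLp.smul_apply, smul_eq_mul]
    ring
  simp only [h4, integral_const_mul] at h3
  rw [h1]
  simp only [h2, LinearIsometryEquiv.norm_map]
  have hd : Module.finrank ℝ Plane = 2 := by simp
  rw [hd, abs_of_pos (by positivity), smul_eq_mul] at h3
  have h5 : r ^ (-2 - s) * r ^ s = (r ^ 2)⁻¹ := by
    rw [← Real.rpow_add hr, ← Real.rpow_natCast, ← Real.rpow_neg hr.le]; norm_num
  have h6 : r ^ (-2 - s) ≠ 0 := (Real.rpow_pos_of_pos hr _).ne'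
  apply mul_left_cancel₀ h6
  rw [h3, ← h5, fracConst]; ring

theorem abs_sin_inner_le_min (ζ η : Plane) :
    |Real.sin (inner ℝ ζ η)| ≤ (1 + ‖ζ‖) * min 1 (‖η‖ ^ (1 : ℝ)) := by
  have h1 := Real.abs_sin_le_one (inner ℝ ζ η)
  have h2 := Real.abs_sin_le_abs (x := inner ℝ ζ η)
  have h3 := abs_real_inner_le_norm ζ η
  rw [Real.rpow_one]
  rcases le_total 1 ‖η‖ with h | h
  · rw [min_eq_left h]; nlinarith [norm_nonneg ζ]
  · rw [min_eq_right h]; nlinarith [norm_nonneg ζ, norm_nonneg η]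

theorem abs_coord_mul_rpow_le (α : ℝ) (η : Plane) (j : Fin 2) :
    |η j * ‖η‖ ^ (-3 - α)| ≤ ‖η‖ ^ (-2 - α) := by
  rcases eq_or_ne η 0 with rfl | h
  · simp; positivity
  have h0 : 0 < ‖η‖ := norm_pos_iff.2 h
  rw [abs_mul, abs_of_nonneg (a := ‖η‖ ^ (-3 - α)) (by positivity)]
  have : ‖η‖ ^ (-2 - α) = ‖η‖ * ‖η‖ ^ (-3 - α) := by
    nth_rw 2 [← Real.rpow_one ‖η‖]
    rw [← Real.rpow_add h0]; ring_nf
  rw [this]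
  gcongr
  simpa using PiLp.norm_apply_le η j

theorem measurable_coord_mul_rpow (α : ℝ) (j : Fin 2) :
    Measurable (fun η : Plane => η j * ‖η‖ ^ (-3 - α)) := by fun_prop

/-- This is the derivative in `ζ_j` of the cosine formula with exponent `1 + α`; here `α < 1` keeps
that exponent below 2. -/
theorem integral_sin_inner_mul {α : ℝ} (hα : 0 < α) (hα1 : α < 1) (ζ : Plane) (j : Fin 2) :
    ∫ η : Plane, Real.sin (inner ℝ ζ η) * (η j * ‖η‖ ^ (-3 - α)) =
      (1 + α) * fracConst (1 + α) * (‖ζ‖ ^ (α - 1) * ζ j) := by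
  rcases eq_or_ne ζ 0 with rfl | hζ
  · simp
  set e : Plane := EuclideanSpace.single j 1
  have hin (η : Plane) : inner ℝ e η = η j := by simp [e, EuclideanSpace.inner_single_left]
  have hexp : (-2 - (1 + α)) = -3 - α := by ring
  let F : ℝ → Plane → ℝ := fun h η =>
    (1 - Real.cos (inner ℝ (ζ + h • e) η)) * ‖η‖ ^ (-2 - (1 + α))
  let F' : ℝ → Plane → ℝ := fun h η =>
    Real.sin (inner ℝ (ζ + h • e) η) * (η j * ‖η‖ ^ (-3 - α))
  have hder := (hasDerivAt_integral_of_dominated_loc_of_deriv_le (μ := volume)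
    (F := F) (F' := F') (x₀ := 0)
    -- On the unit ball of increments, `1 + ‖ζ + h • e‖ ≤ 2 + ‖ζ‖`.
    (bound := fun η => (2 + ‖ζ‖) * (min 1 (‖η‖ ^ (1 : ℝ)) * ‖η‖ ^ (-2 - α)))
    (s := Metric.ball 0 1) (Metric.ball_mem_nhds _ one_pos)
    (Eventually.of_forall fun h => by fun_prop)
    (integrable_one_sub_cos_mul (by linarith) (by linarith) _)
    (by fun_prop)
    (Eventually.of_forall fun η h hh => ?_)
    ((integrable_min_one_rpow_norm hα hα1).const_mul _)
    (Eventually.of_forall fun η h hh => ?_)).2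
  · have h1 : (fun h : ℝ => ∫ η, F h η) = fun h => fracConst (1 + α) * ‖ζ + h • e‖ ^ (1 + α) := by
      funext h
      exact integral_one_sub_cos_inner (by linarith) _
    have h2 : HasDerivAt (fun h : ℝ => fracConst (1 + α) * ‖ζ + h • e‖ ^ (1 + α))
        (fracConst (1 + α) * ((1 + α) * (‖ζ‖ ^ (α - 1) * ζ j))) 0 := by
      have hl : HasDerivAt (fun h : ℝ => ζ + h • e) e 0 := by
        simpa using ((hasDerivAt_id (0 : ℝ)).smul_const e).const_add ζ
      have hsq : HasDerivAt (fun h : ℝ => ‖ζ + h • e‖ ^ 2) (2 * ζ j) 0 := by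
        have := hl.norm_sq
        simpa [real_inner_comm e, hin] using this
      have hpos : 0 < ‖ζ‖ := norm_pos_iff.2 hζ
      have hp := hsq.rpow_const (p := (1 + α) / 2) (Or.inl (by simp [hζ]))
      have heq (z : Plane) : (‖z‖ ^ 2 : ℝ) ^ ((1 + α) / 2) = ‖z‖ ^ (1 + α) := by
        rw [← Real.rpow_natCast, ← Real.rpow_mul (norm_nonneg _)]; push_cast; ring_nf
      simp only [heq] at hp
      refine (hp.const_mul (fracConst (1 + α))).congr_deriv ?_
      have : (‖ζ + (0 : ℝ) • e‖ ^ 2 : ℝ) ^ ((1 + α) / 2 - 1) = ‖ζ‖ ^ (α - 1) := by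
        rw [← Real.rpow_natCast, ← Real.rpow_mul (norm_nonneg _)]; push_cast; ring_nf
        simp
      rw [this]; ring
    rw [h1] at hder
    have h3 := hder.unique h2
    simp only [F', zero_smul, add_zero] at h3
    rw [h3]; ring
  · have hh' : |h| < 1 := by simpa using hh
    have h4 : ‖ζ + h • e‖ ≤ ‖ζ‖ + 1 := by
      refine (norm_add_le _ _).trans ?_
      simp only [e, norm_smul, PiLp.norm_single, Real.norm_eq_abs, abs_one, mul_one]
      linarith
    rw [Real.norm_eq_abs, abs_mul, ← mul_assoc]
    refine mul_le_mul ((abs_sin_inner_le_min _ η).trans ?_) (abs_coord_mul_rpow_le α η j)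
      (abs_nonneg _) (by positivity)
    exact mul_le_mul_of_nonneg_right (by linarith) (by positivity)
  · have hl : HasDerivAt (fun h : ℝ => (inner ℝ (ζ + h • e) η : ℝ)) (η j) h := by
      have : HasDerivAt (fun h : ℝ => ζ + h • e) e h := by
        simpa using ((hasDerivAt_id h).smul_const e).const_add ζ
      simpa [hin] using this.inner ℝ (hasDerivAt_const h η)
    have := ((hl.cos).const_sub 1).mul_const (‖η‖ ^ (-2 - (1 + α)))
    refine this.congr_deriv ?_
    rw [hexp]; ring

/-! ### The Fourier transform on `L²` and `H^m` -/

theorem integral_fourierInv_mul_eq {f g : Plane → ℂ} (hf : Integrable f) (hg : Integrable g) :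
    ∫ ζ, 𝓕⁻ f ζ * g ζ = ∫ x, f x * 𝓕⁻ g x := by
  have hc : Continuous fun p : Plane × Plane => (-innerₗ Plane) p.1 p.2 := continuous_inner.neg
  have h := VectorFourier.integral_fourierIntegral_smul_eq_flip (L := -innerₗ Plane)
    Real.continuous_fourierChar hc hf hg
  have hflip : (-innerₗ Plane).flip = -innerₗ Plane := by
    ext x y; simp [real_inner_comm]
  rw [hflip] at h
  exact h

theorem continuous_fourierInv {f : Plane → ℂ} (hf : Integrable f) : Continuous (𝓕⁻ f) :=
  VectorFourier.fourierIntegral_continuous Real.continuous_fourierChar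
    (L := -innerₗ Plane) continuous_inner.neg hf

theorem tendsto_fourierInv_cocompact (f : Plane → ℂ) :
    Tendsto (𝓕⁻ f) (cocompact Plane) (𝓝 0) := by
  have h := tendsto_integral_exp_inner_smul_cocompact f
  have hneg : Tendsto (fun x : Plane => -x) (cocompact Plane) (cocompact Plane) :=
    (Homeomorph.neg Plane).isClosedEmbedding.tendsto_cocompact
  refine (h.comp hneg).congr fun x => ?_
  simp [Real.fourierInv_eq]

theorem integrable_fourierChar_mul {g : Plane → ℂ} (hg : Integrable g) (x : Plane) :
    Integrable (fun ζ => (Real.fourierChar (inner ℝ ζ x) : ℂ) * g ζ) := by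
  refine hg.bdd_mul (c := 1) (by fun_prop) (Eventually.of_forall fun ζ => (Circle.norm_coe _).le)

theorem fourierInv_eq_integral_mul (g : Plane → ℂ) (x : Plane) :
    𝓕⁻ g x = ∫ ζ, (Real.fourierChar (inner ℝ ζ x) : ℂ) * g ζ := by
  simp [Real.fourierInv_eq, Circle.smul_def]

theorem memLp_ofReal {f : Plane → ℝ} (hf : MemLp f 2 volume) :
    MemLp (fun x => (f x : ℂ)) 2 volume := hf.ofReal

theorem memLp_fourierL2 (f : Plane → ℝ) : MemLp (fourierL2 f) 2 volume := by
  unfold fourierL2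
  split_ifs with h
  · exact Lp.memLp _
  · exact MemLp.zero

/-- The multiplication formula for the Plancherel transform. -/
theorem integral_mul_ofReal_eq {f : Plane → ℝ} (hf : MemLp f 2 volume) (φ : SchwartzMap Plane ℂ) :
    ∫ x, φ x * (f x : ℂ) = ∫ ζ, 𝓕⁻ (φ : Plane → ℂ) ζ * fourierL2 f ζ := by
  have hfc := memLp_ofReal hf
  set F : Lp (α := Plane) ℂ 2 volume := hfc.toLp _
  have h1 : (F : TemperedDistribution Plane ℂ) (𝓕 (𝓕⁻ φ)) =
      ((𝓕 F : Lp (α := Plane) ℂ 2 volume) : TemperedDistribution Plane ℂ) (𝓕⁻ φ) := by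
    rw [← Lp.fourier_toTemperedDistribution_eq]; rfl
  rw [FourierTransform.fourier_fourierInv_eq, Lp.toTemperedDistribution_apply,
    Lp.toTemperedDistribution_apply] at h1
  have h2 : fourierL2 f = (𝓕 F : Lp (α := Plane) ℂ 2 volume) := by
    unfold fourierL2; rw [dif_pos hfc]
  rw [h2, ← SchwartzMap.fourierInv_coe]
  simp only [smul_eq_mul] at h1
  rw [← h1]
  refine integral_congr_ae ?_
  filter_upwards [hfc.coeFn_toLp] with x hx
  rw [hx]

/-- A real test function as a complex Schwartz function. -/
noncomputable def testSchwartz {φ : Plane → ℝ} (h1 : ContDiff ℝ (⊤ : ℕ∞) φ)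
    (h2 : HasCompactSupport φ) : SchwartzMap Plane ℂ :=
  (h2.comp_left (g := Complex.ofRealCLM) rfl).toSchwartzMap
    (Complex.ofRealCLM.contDiff.comp h1)

theorem testSchwartz_apply {φ : Plane → ℝ} (h1 : ContDiff ℝ (⊤ : ℕ∞) φ)
    (h2 : HasCompactSupport φ) (x : Plane) : testSchwartz h1 h2 x = (φ x : ℂ) := rfl

/-- If the transform of `w ∈ L²` is integrable, the inversion formula holds almost everywhere. -/
theorem ae_eq_fourierInv_fourierL2 {w : Plane → ℝ} (hw : MemLp w 2 volume)
    (hi : Integrable (fourierL2 w)) : ∀ᵐ x, (w x : ℂ) = 𝓕⁻ (fourierL2 w) x := by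
  refine ae_eq_of_integral_contDiff_smul_eq
    ((memLp_ofReal hw).locallyIntegrable (by norm_num))
    (continuous_fourierInv hi).locallyIntegrable fun g hg1 hg2 => ?_
  have h := integral_mul_ofReal_eq hw (testSchwartz hg1 hg2)
  rw [integral_fourierInv_mul_eq (testSchwartz hg1 hg2).integrable hi] at h
  simpa [testSchwartz_apply] using h

theorem fourierInv_fourierL2_eq {f : Plane → ℝ} (hf : MemLp f 2 volume) (hc : Continuous f)
    (hi : Integrable (fourierL2 f)) (x : Plane) : 𝓕⁻ (fourierL2 f) x = (f x : ℂ) := by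
  have h := ae_eq_fourierInv_fourierL2 hf hi
  have h2 := (Continuous.ae_eq_iff_eq volume (Complex.continuous_ofReal.comp hc)
    (continuous_fourierInv hi)).1 h
  exact (congrFun h2 x).symm

/-! ### Consequences of `H^m` regularity with `m > 2` -/

/-- The constant of the embedding `H^m → L^∞`. -/
noncomputable def sobolevConst (m : ℝ) : ℝ≥0∞ :=
  (∫⁻ ζ : Plane, ENNReal.ofReal ((1 + ‖(2 * Real.pi) • ζ‖ ^ 2) ^ (1 - m))) ^ (1 / 2 : ℝ)

theorem sobolevConst_lt_top {m : ℝ} (hm : 2 < m) : sobolevConst m < ∞ := by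
  have h1 : Integrable (fun x : Plane => (1 + ‖x‖ ^ 2) ^ (-(2 * (m - 1)) / 2)) :=
    integrable_rpow_neg_one_add_norm_sq (by simp; linarith)
  have h2 := h1.comp_smul (R := 2 * Real.pi) (by positivity)
  have h3 : (fun x : Plane => (1 + ‖(2 * Real.pi) • x‖ ^ 2) ^ (-(2 * (m - 1)) / 2)) =
      fun x : Plane => (1 + ‖(2 * Real.pi) • x‖ ^ 2) ^ (1 - m) := by
    funext x; congr 1; ring
  rw [h3] at h2
  exact ENNReal.rpow_lt_top_of_nonneg (by norm_num) h2.lintegral_lt_top.ne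

/-- Cauchy–Schwarz after splitting the weight as the powers `(1 - m)/2` and `m/2`. Keeping one
derivative on the left is what the velocity formula needs; the first factor is square integrable in
the plane exactly because `m > 2`. -/
theorem lintegral_weight_mul_fourierL2_le (m : ℝ) (f : Plane → ℝ) :
    ∫⁻ ζ, ENNReal.ofReal ((1 + ‖(2 * Real.pi) • ζ‖ ^ 2) ^ (1 / 2 : ℝ)) * ‖fourierL2 f ζ‖ₑ ≤
      sobolevConst m * sobolevNorm m f := by
  have hm := (memLp_fourierL2 f).aestronglyMeasurable
  have h := ENNReal.lintegral_mul_le_Lp_mul_Lq (volume : Measure Plane)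
    (p := 2) (q := 2) (Real.HolderConjugate.two_two)
    (f := fun ζ => ENNReal.ofReal ((1 + ‖(2 * Real.pi) • ζ‖ ^ 2) ^ ((1 - m) / 2)))
    (g := fun ζ => ENNReal.ofReal ((1 + ‖(2 * Real.pi) • ζ‖ ^ 2) ^ (m / 2)) * ‖fourierL2 f ζ‖ₑ)
    (by fun_prop) (by fun_prop)
  have e1 (ζ : Plane) (a : ℝ) :
      ENNReal.ofReal ((1 + ‖(2 * Real.pi) • ζ‖ ^ 2) ^ (a / 2)) ^ (2 : ℝ) =
        ENNReal.ofReal ((1 + ‖(2 * Real.pi) • ζ‖ ^ 2) ^ a) := by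
    rw [ENNReal.ofReal_rpow_of_nonneg (by positivity) (by norm_num),
      ← Real.rpow_mul (by positivity)]
    ring_nf
  simp only [ENNReal.mul_rpow_of_nonneg _ _ (zero_le_two (α := ℝ)), e1] at h
  refine le_trans (le_of_eq (lintegral_congr fun ζ => ?_)) (h.trans (le_of_eq ?_))
  · simp only [Pi.mul_apply]
    rw [← mul_assoc, ← ENNReal.ofReal_mul (by positivity), ← Real.rpow_add (by positivity)]
    ring_nf
  · simp [sobolevConst, sobolevNorm]

theorem one_add_norm_le_weight (ζ : Plane) :
    1 + ‖ζ‖ ≤ 2 * (1 + ‖(2 * Real.pi) • ζ‖ ^ 2) ^ (1 / 2 : ℝ) := by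
  rw [← Real.sqrt_eq_rpow]
  have h1 : ‖ζ‖ ≤ ‖(2 * Real.pi) • ζ‖ := by
    rw [norm_smul, Real.norm_of_nonneg (by positivity)]
    nlinarith [norm_nonneg ζ, Real.pi_gt_three]
  have h2 : (1 : ℝ) ≤ √(1 + ‖(2 * Real.pi) • ζ‖ ^ 2) := by
    rw [Real.one_le_sqrt]; nlinarith [sq_nonneg ‖(2 * Real.pi) • ζ‖]
  have h3 : ‖(2 * Real.pi) • ζ‖ ≤ √(1 + ‖(2 * Real.pi) • ζ‖ ^ 2) := by
    apply Real.le_sqrt_of_sq_le; linarith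
  linarith

theorem integrable_one_add_norm_mul_fourierL2 {m : ℝ} (hm : 2 < m) {f : Plane → ℝ}
    (hf : sobolevNorm m f < ∞) : Integrable (fun ζ => ((1 + ‖ζ‖ : ℝ) : ℂ) * fourierL2 f ζ) := by
  have hmeas := (memLp_fourierL2 f).aestronglyMeasurable
  refine ⟨by fun_prop, ?_⟩
  have h1 := (lintegral_weight_mul_fourierL2_le m f).trans_lt
    (ENNReal.mul_lt_top (sobolevConst_lt_top hm) hf)
  refine lt_of_le_of_lt ?_ (ENNReal.mul_lt_top (ENNReal.ofReal_lt_top (r := 2)) h1)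
  rw [← lintegral_const_mul'' _ (by fun_prop)]
  refine lintegral_mono fun ζ => ?_
  rw [enorm_mul, ← mul_assoc, ← ENNReal.ofReal_mul (by norm_num)]
  gcongr
  rw [← ofReal_norm, Complex.norm_real, Real.norm_of_nonneg (by positivity)]
  exact ENNReal.ofReal_le_ofReal (one_add_norm_le_weight ζ)

theorem integrable_fourierL2 {m : ℝ} (hm : 2 < m) {f : Plane → ℝ} (hf : sobolevNorm m f < ∞) :
    Integrable (fourierL2 f) := by
  refine (integrable_one_add_norm_mul_fourierL2 hm hf).mono
    (memLp_fourierL2 f).aestronglyMeasurable (Eventually.of_forall fun ζ => ?_)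
  rw [norm_mul, Complex.norm_real, Real.norm_of_nonneg (by positivity)]
  nlinarith [norm_nonneg ζ, norm_nonneg (fourierL2 f ζ)]

/-- The embedding `H^m → L^∞`. -/
theorem enorm_le_sobolevNorm {m : ℝ} (hm : 2 < m) {f : Plane → ℝ} (hf : MemH m f)
    (hc : Continuous f) (x : Plane) : ‖f x‖ₑ ≤ sobolevConst m * sobolevNorm m f := by
  have hi := integrable_fourierL2 hm hf.2
  have h1 : ‖f x‖ₑ = ‖𝓕⁻ (fourierL2 f) x‖ₑ := by
    rw [fourierInv_fourierL2_eq hf.1 hc hi]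
    simp [← ofReal_norm]
  rw [h1, fourierInv_eq_integral_mul]
  refine (enorm_integral_le_lintegral_enorm _).trans
    (le_trans (lintegral_mono fun ζ => ?_) (lintegral_weight_mul_fourierL2_le m f))
  rw [enorm_mul]
  gcongr
  rw [← ofReal_norm, Circle.norm_coe]
  refine ENNReal.ofReal_le_ofReal (Real.one_le_rpow ?_ (by norm_num))
  nlinarith [sq_nonneg ‖(2 * Real.pi) • ζ‖]

/-- Riemann–Lebesgue, since `f` is the inverse transform of an integrable function. -/
theorem tendsto_zero_cocompact_of_memH {m : ℝ} (hm : 2 < m) {f : Plane → ℝ} (hf : MemH m f)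
    (hc : Continuous f) : Tendsto f (cocompact Plane) (𝓝 0) := by
  have h := tendsto_fourierInv_cocompact (fourierL2 f)
  have h2 := (Complex.continuous_re.tendsto 0).comp h
  refine h2.congr fun x => ?_
  simp [fourierInv_fourierL2_eq hf.1 hc (integrable_fourierL2 hm hf.2)]

/-! ### Pointwise formulas for the velocity and the fractional Laplacian -/

/-- The symmetric second difference `f z - (f (z + η) + f (z - η)) / 2`. -/
noncomputable def secondDiff (f : Plane → ℝ) (z η : Plane) : ℝ := f z - (f (z + η) + f (z - η)) / 2

theorem inner_two_pi_smul (ζ η : Plane) :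
    (inner ℝ ((2 * Real.pi) • ζ) η : ℝ) = 2 * Real.pi * inner ℝ ζ η := real_inner_smul_left _ _ _

theorem fourierChar_inner_add (ζ x η : Plane) :
    (Real.fourierChar (inner ℝ ζ (x + η)) : ℂ) = Real.fourierChar (inner ℝ ζ x) *
      (Complex.cos (inner ℝ ((2 * Real.pi) • ζ) η : ℝ) +
        Complex.sin (inner ℝ ((2 * Real.pi) • ζ) η : ℝ) * Complex.I) := by
  rw [inner_add_right, AddChar.map_add_eq_mul, Circle.coe_mul,
    Real.fourierChar_apply (inner ℝ ζ η), ← Complex.exp_mul_I, inner_two_pi_smul]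

theorem fourierChar_inner_sub (ζ x η : Plane) :
    (Real.fourierChar (inner ℝ ζ (x - η)) : ℂ) = Real.fourierChar (inner ℝ ζ x) *
      (Complex.cos (inner ℝ ((2 * Real.pi) • ζ) η : ℝ) -
        Complex.sin (inner ℝ ((2 * Real.pi) • ζ) η : ℝ) * Complex.I) := by
  rw [sub_eq_add_neg, fourierChar_inner_add, inner_neg_right]
  push_cast
  rw [Complex.cos_neg, Complex.sin_neg]
  ring

section Inversion

variable {f : Plane → ℝ}

theorem fourierInv_sin_mul (hi : Integrable (fourierL2 f))
    (hinv : ∀ x, 𝓕⁻ (fourierL2 f) x = (f x : ℂ)) (x η : Plane) :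
    ∫ ζ, (Real.fourierChar (inner ℝ ζ x) : ℂ) *
      (((Real.sin (inner ℝ ((2 * Real.pi) • ζ) η) : ℝ) : ℂ) * fourierL2 f ζ) =
      -(Complex.I / 2) * ((f (x + η) - f (x - η) : ℝ) : ℂ) := by
  have hp := integrable_fourierChar_mul hi (x + η)
  have hm := integrable_fourierChar_mul hi (x - η)
  rw [Complex.ofReal_sub, ← hinv, ← hinv, fourierInv_eq_integral_mul, fourierInv_eq_integral_mul,
    ← integral_sub hp hm, ← integral_const_mul]
  refine integral_congr_ae (Eventually.of_forall fun ζ => ?_)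
  simp only
  rw [fourierChar_inner_add, fourierChar_inner_sub, Complex.ofReal_sin]
  linear_combination ((Real.fourierChar (inner ℝ ζ x) : ℂ) * fourierL2 f ζ *
    Complex.sin (inner ℝ ((2 * Real.pi) • ζ) η : ℝ)) * Complex.I_mul_I

theorem fourierInv_one_sub_cos_mul (hi : Integrable (fourierL2 f))
    (hinv : ∀ x, 𝓕⁻ (fourierL2 f) x = (f x : ℂ)) (x η : Plane) :
    𝓕⁻ (fun ζ => ((1 - Real.cos (inner ℝ ((2 * Real.pi) • ζ) η) : ℝ) : ℂ) * fourierL2 f ζ) x =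
      (secondDiff f x η : ℂ) := by
  have h0 := integrable_fourierChar_mul hi x
  have hp := integrable_fourierChar_mul hi (x + η)
  have hm := integrable_fourierChar_mul hi (x - η)
  have : (secondDiff f x η : ℂ) = (f x : ℂ) - 1 / 2 * ((f (x + η) : ℂ) + (f (x - η) : ℂ)) := by
    rw [secondDiff]; push_cast; ring
  rw [this, ← hinv, ← hinv, ← hinv]
  simp only [fourierInv_eq_integral_mul]
  have hpm : Integrable (fun ζ => 1 / 2 * ((Real.fourierChar (inner ℝ ζ (x + η)) : ℂ) *
      fourierL2 f ζ + (Real.fourierChar (inner ℝ ζ (x - η)) : ℂ) * fourierL2 f ζ)) :=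
    (hp.add hm).const_mul _
  rw [← integral_add hp hm, ← integral_const_mul, ← integral_sub h0 hpm]
  refine integral_congr_ae (Eventually.of_forall fun ζ => ?_)
  simp only
  rw [fourierChar_inner_add, fourierChar_inner_sub, Complex.ofReal_sub, Complex.ofReal_cos,
    Complex.ofReal_one]
  ring

end Inversion

/-- The constant `∫ sin⟪ζ, η⟫ η_j |η| ^ (-3 - α) dη = rieszConst α * |ζ| ^ (α - 1) * ζ_j`. -/
noncomputable def rieszConst (α : ℝ) : ℝ := (1 + α) * fracConst (1 + α)

theorem rieszConst_pos {α : ℝ} (hα : 0 < α) (hα1 : α < 1) : 0 < rieszConst α :=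
  mul_pos (by linarith) (fracConst_pos (by linarith) (by linarith))

theorem lambdaSymbol_mul_rieszSymbol {α : ℝ} (hα : 0 < α) (hα1 : α < 1) (j : Fin 2) (ζ : Plane) :
    lambdaSymbol α ζ * rieszSymbol j ζ = -(Complex.I / (rieszConst α : ℂ)) *
      ((∫ η : Plane, Real.sin (inner ℝ ζ η) * (η j * ‖η‖ ^ (-3 - α)) : ℝ) : ℂ) := by
  have hc : ((rieszConst α : ℝ) : ℂ) ≠ 0 := Complex.ofReal_ne_zero.2 (rieszConst_pos hα hα1).ne'
  rw [integral_sin_inner_mul hα hα1, ← rieszConst]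
  rcases eq_or_ne ζ 0 with rfl | hζ
  · simp [lambdaSymbol, rieszSymbol]
  have : ‖ζ‖ ^ α * (ζ j / ‖ζ‖) = ‖ζ‖ ^ (α - 1) * ζ j := by
    rw [Real.rpow_sub_one (norm_pos_iff.2 hζ).ne']; ring
  rw [Complex.ofReal_mul (rieszConst α), ← this, lambdaSymbol, rieszSymbol, Complex.ofReal_mul]
  field_simp

/-- The symbol is an integral of sines against the odd kernel, and each sine acts on `f` as a
centered difference. Fubini is allowed because `|sin|` contributes `(1 + ‖ζ‖) min(1, ‖η‖)`: the
first factor is absorbed by the regularity of `f`, the second by the kernel. The sign `τ` serves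
both components of `R^⊥`. -/
theorem velocity_eq_singular_integral {α m τ : ℝ} (hα : 0 < α) (hα1 : α < 1) (hm : 2 < m)
    {f w : Plane → ℝ} (hf : MemH m f) (hc : Continuous f) (j : Fin 2) (hw : MemLp w 2 volume)
    (hwf : ∀ᵐ ζ, fourierL2 w ζ = τ * (lambdaSymbol α ((2 * Real.pi) • ζ) *
      rieszSymbol j ((2 * Real.pi) • ζ)) * fourierL2 f ζ) :
    ∃ W : Plane → ℝ, Continuous W ∧ (∀ᵐ x, w x = W x) ∧ ∀ x,
      Integrable (fun η : Plane => η j * ‖η‖ ^ (-3 - α) * (f (x + η) - f (x - η))) ∧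
      W x = -(τ / (2 * rieszConst α)) *
        ∫ η : Plane, η j * ‖η‖ ^ (-3 - α) * (f (x + η) - f (x - η)) := by
  have hcα := rieszConst_pos hα hα1
  have hi := integrable_fourierL2 hm hf.2
  have hinv := fourierInv_fourierL2_eq hf.1 hc hi
  have hmeas := (memLp_fourierL2 f).aestronglyMeasurable
  have hi1 := integrable_one_add_norm_mul_fourierL2 hm hf.2
  have hk := integrable_min_one_rpow_norm hα hα1
  have hprod := (hi1.norm.mul_prod hk).const_mul (2 * Real.pi)
  have hx (x : Plane) : Integrable (fun p : Plane × Plane =>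
      (Real.fourierChar (inner ℝ p.1 x) : ℂ) *
        (((Real.sin (inner ℝ ((2 * Real.pi) • p.1) p.2) : ℝ) : ℂ) * fourierL2 f p.1) *
        ((p.2 j * ‖p.2‖ ^ (-3 - α) : ℝ) : ℂ)) (volume.prod volume) := by
    refine hprod.mono' ?_ (Eventually.of_forall fun p => ?_)
    · have h1 := hmeas.comp_fst (ν := (volume : Measure Plane))
      have h2 : Measurable (fun p : Plane × Plane => ((p.2 j * ‖p.2‖ ^ (-3 - α) : ℝ) : ℂ)) :=
        Complex.measurable_ofReal.comp ((measurable_coord_mul_rpow α j).comp measurable_snd)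
      refine AEStronglyMeasurable.mul (AEStronglyMeasurable.mul ?_ (AEStronglyMeasurable.mul ?_ h1))
        h2.aestronglyMeasurable
      · exact Continuous.aestronglyMeasurable (by fun_prop)
      · exact Continuous.aestronglyMeasurable (by fun_prop)
    · rw [norm_mul, norm_mul, norm_mul, Circle.norm_coe, one_mul, Complex.norm_real,
        Complex.norm_real, Real.norm_eq_abs, Real.norm_eq_abs, norm_mul, Complex.norm_real,
        Real.norm_of_nonneg (r := 1 + ‖p.1‖) (by positivity)]
      have h1 := abs_sin_inner_le_min ((2 * Real.pi) • p.1) p.2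
      have h2 := abs_coord_mul_rpow_le α p.2 j
      have h3 : 1 + ‖(2 * Real.pi) • p.1‖ ≤ 2 * Real.pi * (1 + ‖p.1‖) := by
        rw [norm_smul, Real.norm_of_nonneg (by positivity)]
        nlinarith [Real.pi_gt_three]
      have h4 : |Real.sin (inner ℝ ((2 * Real.pi) • p.1) p.2)| ≤
          2 * Real.pi * (1 + ‖p.1‖) * min 1 (‖p.2‖ ^ (1 : ℝ)) :=
        h1.trans (mul_le_mul_of_nonneg_right h3 (by positivity))
      calc _ ≤ 2 * Real.pi * (1 + ‖p.1‖) * min 1 (‖p.2‖ ^ (1 : ℝ)) * ‖fourierL2 f p.1‖ *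
            ‖p.2‖ ^ (-2 - α) := by gcongr
        _ = _ := by ring
  have hsym : fourierL2 w =ᵐ[volume] fun ζ => -(τ * (Complex.I / (rieszConst α : ℂ))) *
      ∫ η : Plane, (((Real.sin (inner ℝ ((2 * Real.pi) • ζ) η) : ℝ) : ℂ) * fourierL2 f ζ) *
        ((η j * ‖η‖ ^ (-3 - α) : ℝ) : ℂ) := by
    filter_upwards [hwf] with ζ hζ
    rw [hζ, lambdaSymbol_mul_rieszSymbol hα hα1, ← integral_complex_ofReal]
    have : ∀ η : Plane, (((Real.sin (inner ℝ ((2 * Real.pi) • ζ) η) : ℝ) : ℂ) * fourierL2 f ζ) *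
        ((η j * ‖η‖ ^ (-3 - α) : ℝ) : ℂ) =
        ((Real.sin (inner ℝ ((2 * Real.pi) • ζ) η) * (η j * ‖η‖ ^ (-3 - α)) : ℝ) : ℂ) *
          fourierL2 f ζ := fun η => by push_cast; ring
    simp only [this]
    rw [integral_mul_const]
    ring
  have hint : Integrable (fourierL2 w) := by
    -- At `x = 0` the character is 1, so the inner integral over `η` is the transform of `w` up to a
    -- constant.
    have h := (hx 0).integral_prod_left.const_mul (-(τ * (Complex.I / (rieszConst α : ℂ))))
    refine (integrable_congr hsym).2 (h.congr (Eventually.of_forall fun ζ => ?_))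
    simp
  have hval (x : Plane) : 𝓕⁻ (fourierL2 w) x = ((-(τ / (2 * rieszConst α)) *
        ∫ η : Plane, η j * ‖η‖ ^ (-3 - α) * (f (x + η) - f (x - η)) : ℝ) : ℂ) := by
    have h1 : 𝓕⁻ (fourierL2 w) x = -(τ * (Complex.I / (rieszConst α : ℂ))) *
        ∫ ζ, ∫ η : Plane, (Real.fourierChar (inner ℝ ζ x) : ℂ) *
        (((Real.sin (inner ℝ ((2 * Real.pi) • ζ) η) : ℝ) : ℂ) * fourierL2 f ζ) *
        ((η j * ‖η‖ ^ (-3 - α) : ℝ) : ℂ) := by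
      rw [fourierInv_eq_integral_mul, ← integral_const_mul]
      refine integral_congr_ae ?_
      filter_upwards [hsym] with ζ hζ
      rw [hζ]
      simp only [mul_assoc (Real.fourierChar (inner ℝ ζ x) : ℂ)]
      rw [integral_const_mul]
      ring
    rw [h1, integral_integral_swap (hx x)]
    simp only [integral_mul_const, fourierInv_sin_mul hi hinv]
    rw [Complex.ofReal_mul, ← integral_complex_ofReal]
    have h2 : ∀ η : Plane, -(Complex.I / 2) * ((f (x + η) - f (x - η) : ℝ) : ℂ) *
        ((η j * ‖η‖ ^ (-3 - α) : ℝ) : ℂ) = -(Complex.I / 2) *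
        ((η j * ‖η‖ ^ (-3 - α) * (f (x + η) - f (x - η)) : ℝ) : ℂ) := fun η => by
      push_cast; ring
    simp only [h2]
    rw [integral_const_mul]
    push_cast
    have hne : ((rieszConst α : ℝ) : ℂ) ≠ 0 := Complex.ofReal_ne_zero.2 hcα.ne'
    field_simp
    rw [Complex.I_sq]
    ring
  refine ⟨fun x => (𝓕⁻ (fourierL2 w) x).re,
    Complex.continuous_re.comp (continuous_fourierInv hint), ?_, fun x => ⟨?_, ?_⟩⟩
  · filter_upwards [ae_eq_fourierInv_fourierL2 hw hint] with x hx'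
    rw [← hx', Complex.ofReal_re]
  · have h := (hx x).integral_prod_right
    simp only [integral_mul_const, fourierInv_sin_mul hi hinv] at h
    have h2 := (h.const_mul (2 * Complex.I)).re
    refine h2.congr (Eventually.of_forall fun η => ?_)
    have h3 : 2 * Complex.I * (-(Complex.I / 2) * ((f (x + η) - f (x - η) : ℝ) : ℂ) *
        ((η j * ‖η‖ ^ (-3 - α) : ℝ) : ℂ)) =
        ((η j * ‖η‖ ^ (-3 - α) * (f (x + η) - f (x - η)) : ℝ) : ℂ) := by
      push_cast
      linear_combination (-((f (x + η) : ℂ) - f (x - η)) * ((η j : ℂ) *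
        ((‖η‖ ^ (-3 - α) : ℝ) : ℂ))) * Complex.I_mul_I
    simp only
    rw [h3]
    exact Complex.ofReal_re _
  · simp only [hval, Complex.ofReal_re]

/-! ### Second differences and the fractional Laplacian -/

/-- The mean value inequality is used twice, for the derivative and then for `f` minus its linear
part. The bound is local in `z`, by compactness, since no global bound on second derivatives is
assumed. -/
theorem abs_secondDiff_le_of_norm_le_one {f : Plane → ℝ} (hf : ContDiff ℝ 2 f) (R : ℝ) :
    ∃ M : ℝ, 0 ≤ M ∧ ∀ z ∈ Metric.closedBall (0 : Plane) R, ∀ η : Plane, ‖η‖ ≤ 1 →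
      |secondDiff f z η| ≤ M * ‖η‖ ^ 2 := by
  have hd : Differentiable ℝ f := hf.differentiable (by norm_num)
  have hf' : ContDiff ℝ 1 (fderiv ℝ f) := hf.fderiv_right (by norm_num)
  have hdf' : Differentiable ℝ (fderiv ℝ f) := hf'.differentiable (by norm_num)
  obtain ⟨M, hM⟩ := (isCompact_closedBall (0 : Plane) (R + 1)).exists_bound_of_continuousOn
    (hf'.continuous_fderiv (by norm_num)).continuousOn
  refine ⟨|M|, abs_nonneg M, fun z hz η hη => ?_⟩
  have hsub {w : Plane} (hw : w ∈ Metric.closedBall z ‖η‖) :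
      w ∈ Metric.closedBall (0 : Plane) (R + 1) := by
    rw [mem_closedBall_zero_iff] at hz ⊢
    rw [mem_closedBall_iff_norm] at hw
    calc ‖w‖ = ‖z + (w - z)‖ := by simp
      _ ≤ ‖z‖ + ‖w - z‖ := norm_add_le _ _
      _ ≤ R + 1 := by linarith
  have h1 (w : Plane) (hw : w ∈ Metric.closedBall z ‖η‖) :
      ‖fderiv ℝ f w - fderiv ℝ f z‖ ≤ |M| * ‖η‖ := by
    refine ((convex_closedBall z ‖η‖).norm_image_sub_le_of_norm_fderiv_le (𝕜 := ℝ)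
      (fun y _ => hdf' y) (fun y hy => (hM y (hsub hy)).trans (le_abs_self M))
      (Metric.mem_closedBall_self (norm_nonneg η)) hw).trans ?_
    gcongr
    exact mem_closedBall_iff_norm.1 hw
  have h2 (w : Plane) (hw : ‖w - z‖ = ‖η‖) :
      ‖f w - f z - fderiv ℝ f z (w - z)‖ ≤ |M| * ‖η‖ * ‖η‖ := by
    have := (convex_closedBall z ‖η‖).norm_image_sub_le_of_norm_fderiv_le' (𝕜 := ℝ)
      (fun y _ => hd y) h1 (Metric.mem_closedBall_self (norm_nonneg η))
      (mem_closedBall_iff_norm.2 hw.le)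
    rwa [hw] at this
  have hp := h2 (z + η) (by simp)
  have hm := h2 (z - η) (by simp)
  have e2 : z - η - z = -η := by abel
  rw [add_sub_cancel_left, Real.norm_eq_abs, abs_le] at hp
  rw [e2, map_neg, Real.norm_eq_abs, abs_le] at hm
  rw [secondDiff, abs_le]
  constructor <;> nlinarith

theorem abs_secondDiff_le {f : Plane → ℝ} (hf : ContDiff ℝ 2 f) {B : ℝ} (hB : ∀ x, |f x| ≤ B)
    (R : ℝ) : ∃ M : ℝ, 0 ≤ M ∧ ∀ z ∈ Metric.closedBall (0 : Plane) R, ∀ η : Plane,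
      |secondDiff f z η| ≤ M * min 1 (‖η‖ ^ (2 : ℝ)) := by
  obtain ⟨M, hM0, hM⟩ := abs_secondDiff_le_of_norm_le_one hf R
  have hB0 : 0 ≤ B := (abs_nonneg _).trans (hB 0)
  refine ⟨M + 2 * B, by positivity, fun z hz η => ?_⟩
  rw [Real.rpow_two]
  rcases le_total ‖η‖ 1 with h | h
  · rw [min_eq_right (by nlinarith [norm_nonneg η])]
    refine (hM z hz η h).trans ?_
    gcongr
    linarith
  · rw [min_eq_left (by nlinarith)]
    have h1 := abs_le.1 (hB z)
    have h2 := abs_le.1 (hB (z + η))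
    have h3 := abs_le.1 (hB (z - η))
    rw [secondDiff, abs_le]
    constructor <;> linarith

theorem continuous_secondDiff {f : Plane → ℝ} (hc : Continuous f) :
    Continuous fun p : Plane × Plane => secondDiff f p.1 p.2 := by
  unfold secondDiff; fun_prop

theorem integrable_secondDiff_mul {β : ℝ} (hβ : 0 < β) (hβ2 : β < 2) {f : Plane → ℝ}
    (hf : ContDiff ℝ 2 f) {B : ℝ} (hB : ∀ x, |f x| ≤ B) (z : Plane) :
    Integrable fun η : Plane => secondDiff f z η * ‖η‖ ^ (-2 - β) := by
  obtain ⟨M, hM0, hM⟩ := abs_secondDiff_le hf hB ‖z‖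
  have hcs := (continuous_secondDiff hf.continuous).comp (Continuous.prodMk_right z)
  refine ((integrable_min_one_rpow_norm hβ hβ2).const_mul M).mono'
    (hcs.aestronglyMeasurable.mul (Measurable.aestronglyMeasurable (by fun_prop))) (Eventually.of_forall fun η => ?_)
  rw [Real.norm_eq_abs, abs_mul, abs_of_nonneg (a := ‖η‖ ^ (-2 - β)) (by positivity), ← mul_assoc]
  gcongr
  exact hM z (by simp) η

/-- The singular integral form of `Λ^β f`. -/
noncomputable def fracLap (β : ℝ) (f : Plane → ℝ) (z : Plane) : ℝ :=
  (fracConst β)⁻¹ * ∫ η : Plane, secondDiff f z η * ‖η‖ ^ (-2 - β)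

theorem continuous_fracLap {β : ℝ} (hβ : 0 < β) (hβ2 : β < 2) {f : Plane → ℝ}
    (hf : ContDiff ℝ 2 f) {B : ℝ} (hB : ∀ x, |f x| ≤ B) : Continuous (fracLap β f) := by
  refine Continuous.mul continuous_const (continuous_iff_continuousAt.2 fun z₀ => ?_)
  obtain ⟨M, hM0, hM⟩ := abs_secondDiff_le hf hB (‖z₀‖ + 1)
  have hcs := continuous_secondDiff hf.continuous
  refine continuousAt_of_dominated (bound := fun η => M * (min 1 (‖η‖ ^ (2 : ℝ)) *
    ‖η‖ ^ (-2 - β))) (Eventually.of_forall fun z => ?_) ?_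
    ((integrable_min_one_rpow_norm hβ hβ2).const_mul M) (Eventually.of_forall fun η => ?_)
  · exact (integrable_secondDiff_mul hβ hβ2 hf hB z).aestronglyMeasurable
  · filter_upwards [Metric.ball_mem_nhds z₀ one_pos] with z hz
    refine Eventually.of_forall fun η => ?_
    rw [Real.norm_eq_abs, abs_mul, abs_of_nonneg (a := ‖η‖ ^ (-2 - β)) (by positivity),
      ← mul_assoc]
    gcongr
    refine hM z ?_ η
    rw [mem_closedBall_zero_iff]
    rw [mem_ball_iff_norm] at hz
    have := norm_le_norm_add_norm_sub' z z₀
    linarith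
  · exact ((hcs.comp (Continuous.prodMk_left η)).continuousAt).mul continuousAt_const

theorem lambdaSymbol_eq {β : ℝ} (hβ : 0 < β) (hβ2 : β < 2) (ζ : Plane) :
    lambdaSymbol β ζ = ((fracConst β)⁻¹ : ℝ) *
      ((∫ η : Plane, (1 - Real.cos (inner ℝ ζ η)) * ‖η‖ ^ (-2 - β) : ℝ) : ℂ) := by
  rw [integral_one_sub_cos_inner hβ, lambdaSymbol, ← Complex.ofReal_mul, ← mul_assoc,
    inv_mul_cancel₀ (fracConst_pos hβ hβ2).ne', one_mul]

/-- For `m` near 2 the function `|ζ|^β f̂` need not be integrable, so pointwise inversion is not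
available and the identity is tested against `φ`. Fubini is then applied twice: in frequency, where
the `L²` bound on the transform of `v` gives integrability, and in space, where the compact support
of `φ` makes local bounds on second differences sufficient. -/
theorem ae_eq_fracLap {β m : ℝ} (hβ : 0 < β) (hβ2 : β < 2) (hm : 2 < m) {f v : Plane → ℝ}
    (hfm : MemH m f) (hf : ContDiff ℝ 2 f) {B : ℝ} (hB : ∀ x, |f x| ≤ B)
    (hv : IsFourierMultiplier (lambdaSymbol β) f v) : ∀ᵐ x, v x = fracLap β f x := by
  have hC := fracConst_pos hβ hβ2
  have hi := integrable_fourierL2 hm hfm.2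
  have hinv := fourierInv_fourierL2_eq hfm.1 hf.continuous hi
  have hmeas := (memLp_fourierL2 f).aestronglyMeasurable
  refine ae_eq_of_integral_contDiff_smul_eq (hv.2.1.locallyIntegrable (by norm_num))
    (continuous_fracLap hβ hβ2 hf hB).locallyIntegrable fun φ hφ1 hφ2 => ?_
  set Φ : SchwartzMap Plane ℂ := testSchwartz hφ1 hφ2
  have hΦ : 𝓕⁻ (Φ : Plane → ℂ) = (𝓕⁻ Φ : SchwartzMap Plane ℂ) := (SchwartzMap.fourierInv_coe Φ).symm
  -- the Fourier side
  have hP1 : Integrable (fun p : Plane × Plane => 𝓕⁻ (Φ : Plane → ℂ) p.1 *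
      (((1 - Real.cos (inner ℝ ((2 * Real.pi) • p.1) p.2) : ℝ) : ℂ) * fourierL2 f p.1) *
        ((‖p.2‖ ^ (-2 - β) : ℝ) : ℂ)) (volume.prod volume) := by
    have hF : AEStronglyMeasurable (fun p : Plane × Plane => 𝓕⁻ (Φ : Plane → ℂ) p.1 *
      (((1 - Real.cos (inner ℝ ((2 * Real.pi) • p.1) p.2) : ℝ) : ℂ) * fourierL2 f p.1) *
        ((‖p.2‖ ^ (-2 - β) : ℝ) : ℂ)) (volume.prod volume) := by
      have h1 := hmeas.comp_fst (ν := (volume : Measure Plane))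
      have h2 : Continuous (𝓕⁻ (Φ : Plane → ℂ)) := continuous_fourierInv Φ.integrable
      refine AEStronglyMeasurable.mul (AEStronglyMeasurable.mul ?_ (AEStronglyMeasurable.mul ?_ h1))
        (Measurable.aestronglyMeasurable (by fun_prop))
      · exact (h2.comp continuous_fst).aestronglyMeasurable
      · exact Continuous.aestronglyMeasurable (by fun_prop)
    have hrw (ζ η : Plane) : 𝓕⁻ (Φ : Plane → ℂ) ζ *
      (((1 - Real.cos (inner ℝ ((2 * Real.pi) • ζ) η) : ℝ) : ℂ) * fourierL2 f ζ) *
        ((‖η‖ ^ (-2 - β) : ℝ) : ℂ) = (𝓕⁻ (Φ : Plane → ℂ) ζ * fourierL2 f ζ) *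
        (((1 - Real.cos (inner ℝ ((2 * Real.pi) • ζ) η)) * ‖η‖ ^ (-2 - β) : ℝ) : ℂ) := by
      push_cast; ring
    refine (integrable_prod_iff hF).2 ⟨Eventually.of_forall fun ζ => ?_, ?_⟩
    · simp only [hrw]
      exact (integrable_one_sub_cos_mul hβ hβ2 _).ofReal.const_mul _
    · have h3 : Integrable (fun ζ => ‖𝓕⁻ (Φ : Plane → ℂ) ζ * fourierL2 v ζ‖) := by
        rw [hΦ]
        exact (((𝓕⁻ Φ : SchwartzMap Plane ℂ).memLp 2).integrable_mul (memLp_fourierL2 v)).norm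
      refine (h3.const_mul (fracConst β)).congr ?_
      filter_upwards [hv.2.2] with ζ hζ
      simp only [hrw, norm_mul _ ((_ : ℝ) : ℂ)]
      have hnn (η : Plane) : 0 ≤ (1 - Real.cos (inner ℝ ((2 * Real.pi) • ζ) η)) *
          ‖η‖ ^ (-2 - β) := by
        have := Real.cos_le_one (inner ℝ ((2 * Real.pi) • ζ) η)
        exact mul_nonneg (by linarith) (by positivity)
      simp only [Complex.norm_real, Real.norm_of_nonneg (hnn _)]
      rw [integral_const_mul, integral_one_sub_cos_inner hβ, hζ, lambdaSymbol, norm_mul, norm_mul,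
        norm_mul, Complex.norm_real, Real.norm_of_nonneg (by positivity)]
      ring
  have hleft : ∫ x, φ x • v x = (fracConst β)⁻¹ *
      ∫ η : Plane, (∫ x, φ x * secondDiff f x η) * ‖η‖ ^ (-2 - β) := by
    have h1 := integral_mul_ofReal_eq hv.2.1 Φ
    have h2 : ∫ x, Φ x * (v x : ℂ) = ((∫ x, φ x • v x : ℝ) : ℂ) := by
      rw [← integral_complex_ofReal]
      refine integral_congr_ae (Eventually.of_forall fun x => ?_)
      simp [Φ, testSchwartz_apply]
    have h3 : ∫ ζ, 𝓕⁻ (Φ : Plane → ℂ) ζ * fourierL2 v ζ = ((fracConst β)⁻¹ : ℝ) *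
        ∫ ζ, ∫ η : Plane, 𝓕⁻ (Φ : Plane → ℂ) ζ *
      (((1 - Real.cos (inner ℝ ((2 * Real.pi) • ζ) η) : ℝ) : ℂ) * fourierL2 f ζ) *
        ((‖η‖ ^ (-2 - β) : ℝ) : ℂ) := by
      rw [← integral_const_mul]
      refine integral_congr_ae ?_
      filter_upwards [hv.2.2] with ζ hζ
      rw [hζ, lambdaSymbol_eq hβ hβ2, ← integral_complex_ofReal]
      have : ∀ η : Plane, 𝓕⁻ (Φ : Plane → ℂ) ζ *
        (((1 - Real.cos (inner ℝ ((2 * Real.pi) • ζ) η) : ℝ) : ℂ) * fourierL2 f ζ) *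
        ((‖η‖ ^ (-2 - β) : ℝ) : ℂ) = (𝓕⁻ (Φ : Plane → ℂ) ζ * fourierL2 f ζ) *
        (((1 - Real.cos (inner ℝ ((2 * Real.pi) • ζ) η)) * ‖η‖ ^ (-2 - β) : ℝ) : ℂ) := fun η => by
        push_cast; ring
      simp only [this]
      rw [integral_const_mul]
      ring
    rw [integral_integral_swap hP1] at h3
    have h4 (η : Plane) : ∫ ζ, 𝓕⁻ (Φ : Plane → ℂ) ζ *
        (((1 - Real.cos (inner ℝ ((2 * Real.pi) • ζ) η) : ℝ) : ℂ) * fourierL2 f ζ) *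
        ((‖η‖ ^ (-2 - β) : ℝ) : ℂ) = (((∫ x, φ x * secondDiff f x η) * ‖η‖ ^ (-2 - β) : ℝ) : ℂ) := by
      have hg : Integrable (fun ζ => ((1 - Real.cos (inner ℝ ((2 * Real.pi) • ζ) η) : ℝ) : ℂ) *
          fourierL2 f ζ) := by
        refine hi.bdd_mul (c := 2) (Continuous.aestronglyMeasurable (by fun_prop))
          (Eventually.of_forall fun ζ => ?_)
        rw [Complex.norm_real, Real.norm_eq_abs, abs_le]
        constructor <;> linarith [Real.cos_le_one (inner ℝ ((2 * Real.pi) • ζ) η),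
          Real.neg_one_le_cos (inner ℝ ((2 * Real.pi) • ζ) η)]
      rw [integral_mul_const, integral_fourierInv_mul_eq Φ.integrable hg, Complex.ofReal_mul,
        ← integral_complex_ofReal]
      congr 1
      refine integral_congr_ae (Eventually.of_forall fun x => ?_)
      simp only
      rw [fourierInv_one_sub_cos_mul hi hinv, Complex.ofReal_mul]
      rfl
    simp only [h4] at h3
    rw [h2, h3, integral_complex_ofReal, ← Complex.ofReal_mul] at h1
    exact Complex.ofReal_injective h1
  -- the physical side
  obtain ⟨R, hR⟩ := hφ2.isCompact.isBounded.subset_closedBall (0 : Plane)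
  obtain ⟨M, hM0, hM⟩ := abs_secondDiff_le hf hB R
  have hP2 : Integrable (fun p : Plane × Plane =>
      φ p.1 * secondDiff f p.1 p.2 * ‖p.2‖ ^ (-2 - β)) (volume.prod volume) := by
    have hφi : Integrable φ := hφ1.continuous.integrable_of_hasCompactSupport hφ2
    refine ((hφi.norm.mul_prod (integrable_min_one_rpow_norm hβ hβ2)).const_mul M).mono' ?_
      (Eventually.of_forall fun p => ?_)
    · exact (((hφ1.continuous.comp continuous_fst).mul
        (continuous_secondDiff hf.continuous)).aestronglyMeasurable).mul
        (Measurable.aestronglyMeasurable (by fun_prop))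
    · rw [norm_mul, norm_mul, Real.norm_of_nonneg (r := ‖p.2‖ ^ (-2 - β)) (by positivity)]
      by_cases hp : φ p.1 = 0
      · simp [hp]
      · have h1 := hM p.1 (hR (subset_tsupport φ hp)) p.2
        rw [← Real.norm_eq_abs] at h1
        calc _ ≤ ‖φ p.1‖ * (M * min 1 (‖p.2‖ ^ (2 : ℝ))) * ‖p.2‖ ^ (-2 - β) := by gcongr
          _ = _ := by ring
  rw [hleft]
  simp only [fracLap, smul_eq_mul, ← mul_assoc, mul_comm _ (fracConst β)⁻¹]
  simp only [mul_assoc (fracConst β)⁻¹]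
  rw [integral_const_mul]
  congr 1
  simp only [← integral_mul_const, ← integral_const_mul]
  rw [← integral_integral_swap hP2]
  simp only [mul_assoc]

/-! ### The equation holds pointwise -/

/-- The integral `∫ η_j |η| ^ (-3 - α) (f (x + η) - f (x - η)) dη`. -/
noncomputable def rieszIntegral (α : ℝ) (f : Plane → ℝ) (j : Fin 2) (x : Plane) : ℝ :=
  ∫ η : Plane, η j * ‖η‖ ^ (-3 - α) * (f (x + η) - f (x - η))

theorem continuous_gradient {f : Plane → ℝ} (hf : ContDiff ℝ 2 f) : Continuous (gradient f) :=
  (InnerProductSpace.toDual ℝ Plane).symm.continuous.comp (hf.continuous_fderiv (by norm_num))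

theorem continuous_laplacian {f : Plane → ℝ} (hf : ContDiff ℝ 2 f) :
    Continuous (Laplacian.laplacian f) := by
  rw [InnerProductSpace.laplacian_eq_iteratedFDeriv_stdOrthonormalBasis]
  have h : Continuous (iteratedFDeriv ℝ 2 f) := hf.continuous_iteratedFDeriv (by norm_num)
  refine continuous_finsetSum _ fun i _ => ?_
  exact (ContinuousMultilinearMap.apply ℝ (fun _ : Fin 2 => Plane) ℝ _).continuous.comp h

theorem inner_plane (u p : Plane) : (inner ℝ u p : ℝ) = u 0 * p 0 + u 1 * p 1 := by
  simp [PiLp.inner_apply, Fin.sum_univ_two, mul_comm]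

namespace IsGlobalSmoothSolution

variable {α β ν ε m : ℝ} {θ₀ : Plane → ℝ} {θ : ℝ → Plane → ℝ}

theorem contDiffAt (h : IsGlobalSmoothSolution α β ν ε m θ₀ θ) {t : ℝ} (ht : 0 < t) (x : Plane) :
    ContDiffAt ℝ (⊤ : ℕ∞) (fun p : ℝ × Plane => θ p.1 p.2) (t, x) :=
  h.smooth.contDiffAt ((isOpen_Ioi.prod isOpen_univ).mem_nhds ⟨ht, mem_univ x⟩)

theorem contDiff_slice (h : IsGlobalSmoothSolution α β ν ε m θ₀ θ) {t : ℝ} (ht : 0 < t) :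
    ContDiff ℝ 2 (θ t) := by
  refine contDiff_iff_contDiffAt.2 fun x => ?_
  have h1 : ContDiffAt ℝ (⊤ : ℕ∞) ((fun p : ℝ × Plane => θ p.1 p.2) ∘ fun y => (t, y)) x :=
    (h.contDiffAt ht x).comp x (contDiffAt_const.prodMk contDiffAt_id)
  exact h1.of_le (WithTop.coe_le_coe.2 le_top)

theorem hasDerivAt (h : IsGlobalSmoothSolution α β ν ε m θ₀ θ) {t : ℝ} (ht : 0 < t) (x : Plane) :
    HasDerivAt (fun s => θ s x)
      (fderiv ℝ (fun p : ℝ × Plane => θ p.1 p.2) (t, x) (1, 0)) t := by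
  have h1 := ((h.contDiffAt ht x).differentiableAt (by simp)).hasFDerivAt
  exact h1.comp_hasDerivAt t ((hasDerivAt_id t).prodMk (hasDerivAt_const t x))

theorem continuous_deriv (h : IsGlobalSmoothSolution α β ν ε m θ₀ θ) {t : ℝ} (ht : 0 < t) :
    Continuous fun x => deriv (fun s => θ s x) t := by
  simp only [(h.hasDerivAt ht _).deriv]
  refine continuous_iff_continuousAt.2 fun x => ?_
  have h1 : ContinuousAt (fderiv ℝ (fun p : ℝ × Plane => θ p.1 p.2)) (t, x) :=
    ((h.contDiffAt ht x).fderiv_right (m := 0) (by simp)).continuousAt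
  have h2 : ContinuousAt (fun y : Plane => (t, y)) x := by fun_prop
  exact (h1.comp_of_eq h2 rfl).clm_apply continuousAt_const

theorem continuous_slice (h : IsGlobalSmoothSolution α β ν ε m θ₀ θ) (hc : Continuous θ₀) {t : ℝ}
    (ht : 0 ≤ t) : Continuous (θ t) := by
  rcases ht.eq_or_lt with rfl | ht
  · rwa [h.initial]
  · exact (h.contDiff_slice ht).continuous

theorem exists_bound (h : IsGlobalSmoothSolution α β ν ε m θ₀ θ) (hm : 2 < m) (hc : Continuous θ₀)
    {t : ℝ} (ht : 0 ≤ t) : ∃ B, ∀ x, |θ t x| ≤ B := by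
  refine ⟨(sobolevConst m * sobolevNorm m (θ t)).toReal, fun x => ?_⟩
  have h1 := enorm_le_sobolevNorm hm (h.memH t ht) (h.continuous_slice hc ht) x
  have h2 : sobolevConst m * sobolevNorm m (θ t) < ∞ :=
    ENNReal.mul_lt_top (sobolevConst_lt_top hm) (h.memH t ht).2
  have h3 := ENNReal.toReal_mono h2.ne h1
  simpa using h3

/-- Once velocity and dissipation are replaced by their continuous singular integrals, both sides
are continuous, and an almost-everywhere identity of continuous functions holds everywhere. -/
theorem pointwise_equation (h : IsGlobalSmoothSolution α β ν ε m θ₀ θ) (hα : 0 < α) (hα1 : α < 1)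
    (hβ : 0 < β) (hβ2 : β < 2) (hm : 2 < m) (hc : Continuous θ₀) {t : ℝ} (ht : 0 < t) :
    (∀ j x, Integrable fun η : Plane =>
      η j * ‖η‖ ^ (-3 - α) * (θ t (x + η) - θ t (x - η))) ∧
    ∀ x, deriv (fun s => θ s x) t
      + (1 / (2 * rieszConst α)) * (rieszIntegral α (θ t) 1 x * gradient (θ t) x 0
        - rieszIntegral α (θ t) 0 x * gradient (θ t) x 1)
      + ν * fracLap β (θ t) x - ε * Laplacian.laplacian (θ t) x = 0 := by
  obtain ⟨u, v, ⟨hu0, hu1⟩, hv, heq⟩ := h.equation t ht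
  have hf := h.contDiff_slice ht
  obtain ⟨B, hB⟩ := h.exists_bound hm hc ht.le
  obtain ⟨W0, hW0c, hW0, hW0i⟩ := velocity_eq_singular_integral (τ := -1) hα hα1 hm
    (h.memH t ht.le) hf.continuous 1 hu0.2.1 (by
      filter_upwards [hu0.2.2] with ζ hζ
      rw [hζ]; push_cast; ring)
  obtain ⟨W1, hW1c, hW1, hW1i⟩ := velocity_eq_singular_integral (τ := 1) hα hα1 hm
    (h.memH t ht.le) hf.continuous 0 hu1.2.1 (by
      filter_upwards [hu1.2.2] with ζ hζ
      rw [hζ]; push_cast; ring)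
  have hV := ae_eq_fracLap hβ hβ2 hm (h.memH t ht.le) hf hB hv
  have hVc := continuous_fracLap hβ hβ2 hf hB
  have hg := continuous_gradient hf
  have hgj (j : Fin 2) : Continuous fun x => gradient (θ t) x j :=
    (continuous_apply j).comp ((PiLp.continuous_ofLp 2 _).comp hg)
  have hL := continuous_laplacian hf
  have hD := h.continuous_deriv ht
  have hae : (fun x => deriv (fun s => θ s x) t + (W0 x * gradient (θ t) x 0 +
      W1 x * gradient (θ t) x 1) + ν * fracLap β (θ t) x - ε * Laplacian.laplacian (θ t) x)
      =ᵐ[volume] fun _ => (0 : ℝ) := by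
    filter_upwards [heq, hW0, hW1, hV] with x h1 h2 h3 h4
    rw [← h1, inner_plane, h2, h3, h4]
  have hall := (Continuous.ae_eq_iff_eq volume ((((hD.add ((hW0c.mul (hgj 0)).add
    (hW1c.mul (hgj 1))))).add (hVc.const_mul ν)).sub (hL.const_mul ε)) continuous_const).1 hae
  refine ⟨fun j x => ?_, fun x => ?_⟩
  · fin_cases j
    · exact (hW1i x).1
    · exact (hW0i x).1
  · have h1 := congrFun hall x
    have h2 := (hW0i x).2
    have h3 := (hW1i x).2
    rw [← rieszIntegral] at h2 h3
    simp only [Pi.add_apply, Pi.sub_apply, Pi.mul_apply, h2, h3] at h1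
    rw [← h1]
    ring

/-- `t ↦ θ t` is continuous in the sup norm. -/
theorem eventually_abs_sub_lt (h : IsGlobalSmoothSolution α β ν ε m θ₀ θ) (hm : 2 < m) (hc : Continuous θ₀)
    {t : ℝ} (ht : 0 ≤ t) {κ : ℝ} (hκ : 0 < κ) :
    ∀ᶠ s in 𝓝[Ici 0] t, ∀ x, |θ s x - θ t x| < κ := by
  have h1 := h.continuous_memH t ht
  have hC := sobolevConst_lt_top hm
  have h2 : Tendsto (fun s => sobolevConst m * sobolevNorm m (θ s - θ t)) (𝓝[Ici 0] t) (𝓝 0) := by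
    simpa using ENNReal.Tendsto.const_mul h1 (Or.inr hC.ne)
  have h3 := h2.eventually_lt_const (ENNReal.ofReal_pos.2 hκ)
  have h4 := h1.eventually_lt_const ENNReal.zero_lt_top
  filter_upwards [h3, h4, self_mem_nhdsWithin] with s hs hs' hs0 x
  have hmem : MemH m (θ s - θ t) := ⟨(h.memH s hs0).1.sub (h.memH t ht).1, hs'⟩
  have h5 := (enorm_le_sobolevNorm hm hmem
    ((h.continuous_slice hc hs0).sub (h.continuous_slice hc ht)) x).trans_lt hs
  rw [← ofReal_norm, ENNReal.ofReal_lt_ofReal_iff hκ] at h5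
  simpa using h5

theorem continuousOn (h : IsGlobalSmoothSolution α β ν ε m θ₀ θ) (hm : 2 < m)
    (hc : Continuous θ₀) : ContinuousOn (fun p : ℝ × Plane => θ p.1 p.2) (Ici 0 ×ˢ univ) := by
  rintro ⟨t, x⟩ ⟨ht, -⟩
  rw [ContinuousWithinAt, nhdsWithin_prod_eq, nhdsWithin_univ, Metric.tendsto_nhds]
  intro κ hκ
  have h1 := h.eventually_abs_sub_lt hm hc ht (half_pos hκ)
  have h2 : ∀ᶠ y in 𝓝 x, |θ t y - θ t x| < κ / 2 := by
    have := Metric.tendsto_nhds.1 ((h.continuous_slice hc ht).tendsto x) (κ / 2) (half_pos hκ)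
    simpa [Real.dist_eq] using this
  filter_upwards [h1.prod_mk h2] with p hp
  rw [Real.dist_eq]
  have h3 := abs_sub_le (θ p.1 p.2) (θ t p.2) (θ t x)
  linarith [hp.1 p.2, hp.2]

/-- A radius that works at one time with `κ / 2` works with `κ` at nearby times, by continuity in
the sup norm; compactness of `[0, T]` makes it uniform. -/
theorem exists_decay_radius (h : IsGlobalSmoothSolution α β ν ε m θ₀ θ) (hm : 2 < m)
    (hc : Continuous θ₀) (T : ℝ) {κ : ℝ} (hκ : 0 < κ) :
    ∃ R, ∀ t ∈ Icc 0 T, ∀ x, R < ‖x‖ → |θ t x| < κ := by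
  refine isCompact_Icc.induction_on (p := fun s : Set ℝ =>
    ∃ R, ∀ t ∈ s ∩ Icc 0 T, ∀ x, R < ‖x‖ → |θ t x| < κ) ?_ ?_ ?_ ?_ |>.imp
      fun R hR t ht => hR t ⟨ht, ht⟩
  · exact ⟨0, by simp⟩
  · rintro s s' hss ⟨R, hR⟩
    exact ⟨R, fun t ht => hR t ⟨hss ht.1, ht.2⟩⟩
  · rintro s s' ⟨R, hR⟩ ⟨R', hR'⟩
    refine ⟨max R R', fun t ht x hx => ?_⟩
    rcases ht.1 with h1 | h1
    · exact hR t ⟨h1, ht.2⟩ x ((le_max_left _ _).trans_lt hx)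
    · exact hR' t ⟨h1, ht.2⟩ x ((le_max_right _ _).trans_lt hx)
  · intro t ht
    have h1 := h.eventually_abs_sub_lt hm hc ht.1 (half_pos hκ)
    have h2 := tendsto_zero_cocompact_of_memH hm (h.memH t ht.1) (h.continuous_slice hc ht.1)
    have h3 := Metric.tendsto_nhds.1 h2 (κ / 2) (half_pos hκ)
    obtain ⟨R, -, hR⟩ := (hasBasis_cobounded_norm (E := Plane)).eventually_iff.1
      (Metric.cobounded_eq_cocompact (α := Plane) ▸ h3)
    refine ⟨{s | ∀ x, |θ s x - θ t x| < κ / 2}, nhdsWithin_mono t Icc_subset_Ici_self h1,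
      R, fun s hs x hx => ?_⟩
    have h4 : dist (θ t x) 0 < κ / 2 := hR (by simpa using hx.le)
    rw [Real.dist_eq, sub_zero] at h4
    have h5 := abs_sub_abs_le_abs_sub (θ s x) (θ t x)
    linarith [hs.1 x]

end IsGlobalSmoothSolution

/-! ### Maximum points and first touching times -/

/-- A positive second derivative would make the maximum also a local minimum, so `φ` would be
locally constant. -/
theorem deriv_deriv_nonpos_of_isMax {φ : ℝ → ℝ} (hc : ContinuousAt φ 0) (hmax : ∀ t, φ t ≤ φ 0) :
    deriv (deriv φ) 0 ≤ 0 := by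
  by_contra! hpos
  have hd : deriv φ 0 = 0 := IsLocalMax.deriv_eq_zero (Eventually.of_forall hmax)
  have hmin := isLocalMin_of_deriv_deriv_pos hpos hd hc
  have heq : φ =ᶠ[𝓝 0] fun _ => φ 0 := by
    filter_upwards [hmin] with t ht using le_antisymm (hmax t) ht
  have h2 : deriv (deriv φ) 0 = 0 := by
    rw [heq.deriv.deriv_eq]
    simp
  exact hpos.ne' h2

theorem laplacian_nonpos_of_isMax {F : Plane → ℝ} (hF : ContDiff ℝ 2 F) {x : Plane}
    (hmax : ∀ y, F y ≤ F x) : Laplacian.laplacian F x ≤ 0 := by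
  rw [InnerProductSpace.laplacian_eq_iteratedFDeriv_stdOrthonormalBasis]
  refine Finset.sum_nonpos fun i _ => ?_
  set e := stdOrthonormalBasis ℝ Plane i
  have hd : Differentiable ℝ F := hF.differentiable (by norm_num)
  have hd' : Differentiable ℝ (fderiv ℝ F) :=
    (hF.fderiv_right (m := 1) (by norm_num)).differentiable (by norm_num)
  have hl (t : ℝ) : HasDerivAt (fun t : ℝ => x + t • e) e t := by
    simpa using ((hasDerivAt_id t).smul_const e).const_add x
  have h1 (t : ℝ) : HasDerivAt (fun t : ℝ => F (x + t • e)) (fderiv ℝ F (x + t • e) e) t :=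
    (hd _).hasFDerivAt.comp_hasDerivAt t (hl t)
  have h2 : HasDerivAt (fun t : ℝ => fderiv ℝ F (x + t • e) e)
      (fderiv ℝ (fderiv ℝ F) (x + (0 : ℝ) • e) e e) 0 := by
    have h3 : HasDerivAt (fun t : ℝ => fderiv ℝ F (x + t • e))
        (fderiv ℝ (fderiv ℝ F) (x + (0 : ℝ) • e) e) 0 :=
      (hd' _).hasFDerivAt.comp_hasDerivAt (0 : ℝ) (hl 0)
    simpa using h3.clm_apply (hasDerivAt_const (0 : ℝ) e)
  have h4 := deriv_deriv_nonpos_of_isMax (φ := fun t : ℝ => F (x + t • e)) (h1 0).continuousAt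
    (fun t => by simpa using hmax _)
  rw [show deriv (fun t : ℝ => F (x + t • e)) = fun t => fderiv ℝ F (x + t • e) e from
    funext fun t => (h1 t).deriv, h2.deriv] at h4
  rw [iteratedFDeriv_two_apply]
  simpa using h4

/-- First-order condition when both points are translated by the same vector. -/
theorem gradient_eq_of_isMax_sub {f : Plane → ℝ} (hf : Differentiable ℝ f) {x y : Plane}
    (hmax : ∀ η, f (x + η) - f (y + η) ≤ f x - f y) : gradient f x = gradient f y := by
  have hx : HasFDerivAt (fun η : Plane => f (x + η)) (fderiv ℝ f x) 0 := by
    have := (hf (x + 0)).hasFDerivAt.comp (0 : Plane) ((hasFDerivAt_id (0 : Plane)).const_add x)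
    rw [add_zero] at this
    exact this
  have hy : HasFDerivAt (fun η : Plane => f (y + η)) (fderiv ℝ f y) 0 := by
    have := (hf (y + 0)).hasFDerivAt.comp (0 : Plane) ((hasFDerivAt_id (0 : Plane)).const_add y)
    rw [add_zero] at this
    exact this
  have h0 := IsLocalMax.hasFDerivAt_eq_zero (f := fun η => f (x + η) - f (y + η))
    (Eventually.of_forall fun η => by simpa using hmax η) (hx.sub hy)
  rw [gradient, gradient, sub_eq_zero.1 h0]

theorem laplacian_le_of_isMax_sub {f : Plane → ℝ} (hf : ContDiff ℝ 2 f) {x y : Plane}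
    (hmax : ∀ η, f (x + η) - f (y + η) ≤ f x - f y) :
    Laplacian.laplacian f x ≤ Laplacian.laplacian f y := by
  have hs (z : Plane) : ContDiff ℝ 2 fun η => f (z + η) := hf.comp (contDiff_const.add contDiff_id)
  have hl (z : Plane) : Laplacian.laplacian (fun η => f (z + η)) 0 = Laplacian.laplacian f z := by
    simp [InnerProductSpace.laplacian_eq_iteratedFDeriv_stdOrthonormalBasis,
      iteratedFDeriv_comp_add_left]
  have h1 := laplacian_nonpos_of_isMax (F := (fun η => f (x + η)) - fun η => f (y + η))
    ((hs x).sub (hs y)) (x := 0) (fun η => by simpa using hmax η)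
  rw [(hs x).contDiffAt.laplacian_sub (hs y).contDiffAt, hl, hl] at h1
  linarith

/-- If a function of time and space starts negative, can only be nonnegative in a compact set, and
has a negative left time derivative at every point where it vanishes at its spatial maximum, it stays
negative. -/
theorem neg_of_first_touching {X : Type*} [TopologicalSpace X] {T : ℝ} {Φ : ℝ → X → ℝ} {K : Set X}
    (hK : IsCompact K) (hΦ : ContinuousOn (fun p : ℝ × X => Φ p.1 p.2) (Icc 0 T ×ˢ univ))
    (hin : ∀ t ∈ Icc 0 T, ∀ p, 0 ≤ Φ t p → p ∈ K) (h0 : ∀ p, Φ 0 p < 0)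
    (htouch : ∀ t ∈ Ioc 0 T, ∀ p, Φ t p = 0 → (∀ q, Φ t q ≤ 0) →
      ∃ d < 0, HasDerivWithinAt (fun s => Φ s p) d (Iic t) t) :
    ∀ t ∈ Icc 0 T, ∀ p, Φ t p < 0 := by
  by_contra! hcon
  obtain ⟨t', ht', p', hp'⟩ := hcon
  have hΦK : ContinuousOn (fun p : ℝ × X => Φ p.1 p.2) (Icc 0 T ×ˢ K) :=
    hΦ.mono (prod_mono_right (subset_univ _))
  have hcpt : IsCompact {p : ℝ × X | p ∈ Icc 0 T ×ˢ K ∧ 0 ≤ Φ p.1 p.2} := by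
    have h1 := continuousOn_iff_continuous_domRestrict.1 hΦK
    have : CompactSpace (Icc (0 : ℝ) T ×ˢ K : Set (ℝ × X)) :=
      isCompact_iff_compactSpace.1 (isCompact_Icc.prod hK)
    have h2 : IsCompact {p : (Icc (0 : ℝ) T ×ˢ K : Set (ℝ × X)) | 0 ≤ Φ p.1.1 p.1.2} :=
      (isClosed_le continuous_const h1).isCompact
    convert! h2.image continuous_subtype_val using 1
    ext p
    simp [and_comm]
  obtain ⟨⟨t, p⟩, ⟨⟨ht, -⟩, hp⟩, hmin⟩ := hcpt.exists_isMinOn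
    ⟨(t', p'), ⟨ht', hin t' ht' p' hp'⟩, hp'⟩ continuous_fst.continuousOn
  have hbefore (s : ℝ) (hs : s ∈ Ico 0 t) (q : X) : Φ s q < 0 := by
    by_contra! hq
    have hsT : s ∈ Icc 0 T := ⟨hs.1, hs.2.le.trans ht.2⟩
    have h1 : t ≤ s := hmin (show (s, q) ∈ _ from ⟨⟨hsT, hin s hsT q hq⟩, hq⟩)
    exact hs.2.not_ge h1
  have ht0 : 0 < t := by
    rcases ht.1.eq_or_lt with h | h
    · have h3 := h0 p
      simp only at h
      subst h
      exact absurd hp h3.not_ge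
    · exact h
  have hev : ∀ᶠ s in 𝓝[<] t, s ∈ Ico 0 t := by
    filter_upwards [Ioo_mem_nhdsLT ht0] with s hs using ⟨hs.1.le, hs.2⟩
  have hle (q : X) : Φ t q ≤ 0 := by
    have h1 : ContinuousWithinAt (fun s => Φ s q) (Icc 0 T) t :=
      (hΦ (t, q) ⟨ht, mem_univ q⟩).comp (f := fun s : ℝ => (s, q))
        (by fun_prop) (fun s hs => ⟨hs, mem_univ q⟩)
    have h2 : Tendsto (fun s => Φ s q) (𝓝[<] t) (𝓝 (Φ t q)) := by
      refine h1.mono_left (le_inf inf_le_left (le_principal_iff.2 ?_))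
      filter_upwards [hev] with s hs using ⟨hs.1, hs.2.le.trans ht.2⟩
    exact le_of_tendsto h2 (by filter_upwards [hev] with s hs using (hbefore s hs q).le)
  have hzero : Φ t p = 0 := le_antisymm (hle p) hp
  obtain ⟨d, hd, hder⟩ := htouch t ⟨ht0, ht.2⟩ p hzero hle
  have h1 := hasDerivWithinAt_iff_tendsto_slope.1 hder
  rw [Iic_sdiff_right] at h1
  -- `Φ` is negative before `t` and zero at `t`, so backward difference quotients are nonnegative.
  have h2 : ∀ᶠ s in 𝓝[<] t, 0 ≤ slope (fun s => Φ s p) t s := by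
    filter_upwards [hev] with s hs
    rw [slope_def_field]
    refine div_nonneg_of_nonpos ?_ (by linarith [hs.2])
    linarith [hbefore s hs p]
  exact hd.not_ge (ge_of_tendsto h1 h2)

/-! ### The maximum principle -/

theorem fracLap_const_mul (β σ : ℝ) (f : Plane → ℝ) (x : Plane) :
    fracLap β (fun y => σ * f y) x = σ * fracLap β f x := by
  have (η : Plane) : secondDiff (fun y => σ * f y) x η * ‖η‖ ^ (-2 - β) =
      σ * (secondDiff f x η * ‖η‖ ^ (-2 - β)) := by
    unfold secondDiff; ring
  simp only [fracLap, this, integral_const_mul]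
  ring

theorem fracLap_nonneg_of_isMax {β : ℝ} (hβ : 0 < β) (hβ2 : β < 2) {f : Plane → ℝ} {x : Plane}
    (hmax : ∀ y, f y ≤ f x) : 0 ≤ fracLap β f x := by
  refine mul_nonneg (inv_nonneg.2 (fracConst_pos hβ hβ2).le) (integral_nonneg fun η => ?_)
  refine mul_nonneg ?_ (by positivity)
  rw [secondDiff]
  linarith [hmax (x + η), hmax (x - η)]

namespace IsGlobalSmoothSolution

variable {α β ν ε m : ℝ} {θ₀ : Plane → ℝ} {θ : ℝ → Plane → ℝ}

/-- The transport term vanishes with the gradient, and both dissipative terms have a sign. The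
factor `σ` treats maxima and minima together. -/
theorem mul_deriv_nonpos_of_isMax (h : IsGlobalSmoothSolution α β ν ε m θ₀ θ) (hα : 0 < α)
    (hα1 : α < 1) (hβ : 0 < β) (hβ2 : β < 2) (hν : 0 < ν) (hε : 0 < ε) (hm : 2 < m)
    (hc : Continuous θ₀) {t : ℝ} (ht : 0 < t) {σ : ℝ} (hσ : σ ≠ 0) {x : Plane}
    (hmax : ∀ y, σ * θ t y ≤ σ * θ t x) : σ * deriv (fun s => θ s x) t ≤ 0 := by
  have hf := h.contDiff_slice ht
  have hd : Differentiable ℝ (θ t) := hf.differentiable (by norm_num)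
  have heq := (h.pointwise_equation hα hα1 hβ hβ2 hm hc ht).2 x
  have hgrad : gradient (θ t) x = 0 := by
    have h1 := IsLocalMax.fderiv_eq_zero (f := fun y => σ * θ t y) (Eventually.of_forall hmax)
    rw [fderiv_const_mul (hd x), smul_eq_zero] at h1
    rw [gradient, h1.resolve_left hσ, map_zero]
  have hlap : σ * Laplacian.laplacian (θ t) x ≤ 0 := by
    have h1 := laplacian_nonpos_of_isMax (F := σ • θ t) (hf.const_smul σ) (x := x) hmax
    rwa [InnerProductSpace.laplacian_smul σ hf.contDiffAt, smul_eq_mul] at h1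
  have hfrac : 0 ≤ σ * fracLap β (θ t) x := by
    rw [← fracLap_const_mul]
    exact fracLap_nonneg_of_isMax hβ hβ2 hmax
  simp only [hgrad, PiLp.zero_apply, mul_zero, sub_zero, add_zero] at heq
  have h2 : σ * deriv (fun s => θ s x) t = ε * (σ * Laplacian.laplacian (θ t) x) -
      ν * (σ * fracLap β (θ t) x) := by linear_combination σ * heq
  rw [h2]
  nlinarith [mul_nonneg hν.le hfrac, mul_nonneg hε.le (neg_nonneg.2 hlap)]

theorem abs_le_of_initial_le (h : IsGlobalSmoothSolution α β ν ε m θ₀ θ) (hα : 0 < α)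
    (hα1 : α < 1) (hβ : 0 < β) (hβ2 : β < 2) (hν : 0 < ν) (hε : 0 < ε) (hm : 2 < m)
    (hc : Continuous θ₀) {M : ℝ} (hM : ∀ x, |θ₀ x| ≤ M) {t : ℝ} (ht : 0 ≤ t) (x : Plane) :
    |θ t x| ≤ M := by
  have hM0 : 0 ≤ M := (abs_nonneg _).trans (hM 0)
  have key (σ : ℝ) (hσ : |σ| = 1) : σ * θ t x ≤ M := by
    have hσ0 : σ ≠ 0 := by rintro rfl; simp at hσ
    refine le_of_forall_pos_lt_add fun κ' hκ' => ?_
    -- The barrier `M + κ (1 + s)` grows, which makes the derivative at contact strictly negative,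
    -- and equals `M + κ'` at the final time.
    set κ := κ' / (1 + t)
    have hκ : 0 < κ := by positivity
    obtain ⟨R, hR⟩ := h.exists_decay_radius hm hc t hκ
    have := neg_of_first_touching (T := t) (Φ := fun s y => σ * θ s y - M - κ * (1 + s))
      (isCompact_closedBall (0 : Plane) R) ?_ ?_ ?_ ?_ t ⟨ht, le_rfl⟩ x
    · have h1 : κ * (1 + t) = κ' := by simp only [κ]; field_simp
      simp only [h1] at this
      linarith
    · have h1 := (h.continuousOn hm hc).mono (prod_mono_left
        (Icc_subset_Ici_self : Icc 0 t ⊆ Ici 0))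
      exact ((h1.const_smul σ).sub continuousOn_const).sub (by fun_prop)
    · intro s hs y hy
      rw [mem_closedBall_zero_iff]
      by_contra! hcon
      have h1 := hR s hs y hcon
      have h2 : σ * θ s y ≤ |θ s y| := by
        refine (le_abs_self _).trans ?_
        rw [abs_mul, hσ, one_mul]
      nlinarith [hs.1]
    · intro y
      have h2 : σ * θ 0 y ≤ |θ₀ y| := by
        refine (le_abs_self _).trans ?_
        rw [abs_mul, hσ, one_mul, h.initial]
      simp only [add_zero, mul_one]
      linarith [hM y]
    · intro s hs y hy hq
      refine ⟨σ * deriv (fun s => θ s y) s - κ, ?_, HasDerivAt.hasDerivWithinAt ?_⟩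
      · have := h.mul_deriv_nonpos_of_isMax hα hα1 hβ hβ2 hν hε hm hc hs.1 hσ0 (x := y)
          (fun z => by linarith [hq z])
        linarith
      · have h1 := (h.hasDerivAt hs.1 y).differentiableAt.hasDerivAt
        have h2 := ((h1.const_mul σ).sub_const M).sub
          (((hasDerivAt_id s).const_add 1).const_mul κ)
        rw [mul_one] at h2
        exact h2
  have h1 := key 1 (by simp)
  have h2 := key (-1) (by simp)
  rw [abs_le]
  constructor <;> linarith

end IsGlobalSmoothSolution

/-! ### Functions touching an affine modulus from below -/

/-- `∫_{|η| > 1} |η| ^ (-2 - α) dη`. -/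
noncomputable def tailConst (α : ℝ) : ℝ :=
  ∫ η : Plane, {η : Plane | 1 < ‖η‖}.indicator (fun η => ‖η‖ ^ (-2 - α)) η

theorem tailConst_nonneg (α : ℝ) : 0 ≤ tailConst α :=
  integral_nonneg fun η => indicator_nonneg (fun _ _ => by positivity) η

theorem integrable_tail {α ξ : ℝ} (hα : 0 < α) (hξ : 0 < ξ) :
    Integrable ({η : Plane | ξ < ‖η‖}.indicator fun η => ‖η‖ ^ (-2 - α)) := by
  have hs : MeasurableSet {η : Plane | ξ < ‖η‖} :=
    measurableSet_lt measurable_const measurable_norm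
  have h1 := (integrable_min_one_rpow_norm hα (lt_add_one α)).const_mul
    (max 1 (ξ ^ (-(α + 1))))
  refine h1.mono' (Measurable.aestronglyMeasurable (Measurable.indicator (by fun_prop) hs))
    (Eventually.of_forall fun η => ?_)
  by_cases hη : ξ < ‖η‖
  · rw [indicator_of_mem (show η ∈ {η : Plane | ξ < ‖η‖} from hη),
      Real.norm_of_nonneg (by positivity), ← mul_assoc]
    refine le_mul_of_one_le_left (by positivity) ?_
    rcases le_total 1 (‖η‖ ^ (α + 1)) with h2 | h2
    · rw [min_eq_left h2, mul_one]; exact le_max_left _ _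
    · rw [min_eq_right h2]
      have h3 : ξ ^ (-(α + 1)) * ξ ^ (α + 1) = 1 := by
        rw [← Real.rpow_add hξ]; simp
      refine h3.symm.le.trans ?_
      exact mul_le_mul (le_max_right _ _) (Real.rpow_le_rpow hξ.le hη.le (by linarith))
        (by positivity) (by positivity)
  · rw [indicator_of_notMem (show η ∉ {η : Plane | ξ < ‖η‖} from hη), norm_zero]
    positivity

theorem integral_tail {α ξ : ℝ} (hξ : 0 < ξ) :
    ∫ η : Plane, {η : Plane | ξ < ‖η‖}.indicator (fun η => ‖η‖ ^ (-2 - α)) η =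
      ξ ^ (-α) * tailConst α := by
  have h1 := Measure.integral_comp_smul (volume : Measure Plane)
    ({η : Plane | ξ < ‖η‖}.indicator fun η => ‖η‖ ^ (-2 - α)) ξ
  have h2 (η : Plane) : {η : Plane | ξ < ‖η‖}.indicator (fun η => ‖η‖ ^ (-2 - α)) (ξ • η) =
      ξ ^ (-2 - α) * {η : Plane | 1 < ‖η‖}.indicator (fun η => ‖η‖ ^ (-2 - α)) η := by
    have hn : ‖ξ • η‖ = ξ * ‖η‖ := by rw [norm_smul, Real.norm_of_nonneg hξ.le]
    have hiff : ξ < ξ * ‖η‖ ↔ 1 < ‖η‖ := by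
      constructor <;> intro h <;> nlinarith
    simp only [indicator_apply, mem_ofPred_eq, hn, hiff]
    split_ifs
    · rw [Real.mul_rpow hξ.le (norm_nonneg _)]
    · simp
  simp only [h2, integral_const_mul] at h1
  have hd : Module.finrank ℝ Plane = 2 := by simp
  rw [hd, abs_of_pos (by positivity), smul_eq_mul, ← tailConst] at h1
  have h3 : ξ ^ (-α) = ξ ^ 2 * ξ ^ (-2 - α) := by
    rw [← Real.rpow_natCast, ← Real.rpow_add hξ]; norm_num; ring_nf
  rw [h3, mul_assoc, h1]
  field_simp

section Touching

variable {f : Plane → ℝ} {a L : ℝ} {x y : Plane}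

/-- Moving `x` alone with `y` fixed bounds all one-sided difference quotients by `L`; the gradient
itself is then taken as direction. -/
theorem norm_gradient_le_of_touching (hf : Differentiable ℝ f) (hL : 0 ≤ L)
    (hle : ∀ x' y', f x' - f y' ≤ a + L * ‖x' - y'‖) (heq : f x - f y = a + L * ‖x - y‖) :
    ‖gradient f x‖ ≤ L := by
  have hup (h : Plane) : f (x + h) - f x ≤ L * ‖h‖ := by
    have h1 := hle (x + h) y
    have h2 : ‖x + h - y‖ ≤ ‖x - y‖ + ‖h‖ := by
      rw [add_sub_right_comm]; exact norm_add_le _ _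
    nlinarith
  have h0 : HasFDerivAt f (fderiv ℝ f x) x := (hf x).hasFDerivAt
  have hdir (e : Plane) : fderiv ℝ f x e ≤ L * ‖e‖ := by
    have hl : HasDerivAt (fun t : ℝ => f (x + t • e)) (fderiv ℝ f x e) 0 := by
      have h1 : HasDerivAt (fun t : ℝ => x + t • e) e 0 := by
        simpa using ((hasDerivAt_id (0 : ℝ)).smul_const e).const_add x
      exact HasFDerivAt.comp_hasDerivAt (0 : ℝ) (by simpa using h0) h1
    have hs := (hasDerivAt_iff_tendsto_slope.1 hl).mono_left (nhdsGT_le_nhdsNE (0 : ℝ))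
    refine le_of_tendsto hs ?_
    filter_upwards [self_mem_nhdsWithin] with t ht
    have ht0 : 0 < t := ht
    rw [slope_def_field, sub_zero, div_le_iff₀ ht0]
    have h1 := hup (t • e)
    rw [norm_smul, Real.norm_of_nonneg ht0.le] at h1
    simp only [zero_smul, add_zero]
    nlinarith
  have hg : ‖gradient f x‖ ^ 2 ≤ L * ‖gradient f x‖ := by
    have h1 : fderiv ℝ f x (gradient f x) = ‖gradient f x‖ ^ 2 := by
      rw [← real_inner_self_eq_norm_sq, gradient, InnerProductSpace.toDual_symm_apply]
    rw [← h1]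
    exact hdir _
  rcases (norm_nonneg (gradient f x)).eq_or_lt with h1 | h1
  · rwa [← h1]
  · nlinarith

/-- The symmetrized gap below the modulus, `secondDiff f x η - secondDiff f y η`. -/
theorem gap_nonneg_of_touching
    (hle : ∀ x' y', f x' - f y' ≤ a + L * ‖x' - y'‖) (heq : f x - f y = a + L * ‖x - y‖)
    (η : Plane) : 0 ≤ secondDiff f x η - secondDiff f y η := by
  have h1 := hle (x + η) (y + η)
  have h2 := hle (x - η) (y - η)
  rw [add_sub_add_right_eq_sub] at h1
  rw [sub_sub_sub_cancel_right] at h2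
  unfold secondDiff
  linarith

/-- The modulus bound is applied to the reversed pairs, with the roles of `x` and `y` exchanged. -/
theorem gap_le_of_touching
    (hle : ∀ x' y', f x' - f y' ≤ a + L * ‖x' - y'‖) (heq : f x - f y = a + L * ‖x - y‖)
    (η : Plane) : secondDiff f x η - secondDiff f y η ≤ 2 * (a + L * ‖x - y‖) := by
  have h1 := hle (y + η) (x + η)
  have h2 := hle (y - η) (x - η)
  rw [add_sub_add_right_eq_sub, norm_sub_rev] at h1
  rw [sub_sub_sub_cancel_right, norm_sub_rev] at h2
  unfold secondDiff
  linarith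

/-- In the sum, the values at `x + η` and `y - η` cancel. What remains is `2(a + Lξ)`, with `ξ = ‖x
- y‖`, minus half of two increments over the displacement `2(x - y)`, each at most `a + 2Lξ`. The
intercept is counted twice with a plus sign and only once with a minus sign. -/
theorem le_gap_add_gap_of_touching
    (hle : ∀ x' y', f x' - f y' ≤ a + L * ‖x' - y'‖) (heq : f x - f y = a + L * ‖x - y‖)
    (η : Plane) : a ≤ (secondDiff f x η - secondDiff f y η) +
      (secondDiff f x (η + (x - y)) - secondDiff f y (η + (x - y))) := by
  have h1 := hle (x + (η + (x - y))) (y + η)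
  have h2 := hle (x - η) (y - (η + (x - y)))
  have e1 : x + (η + (x - y)) - (y + η) = (2 : ℝ) • (x - y) := by module
  have e2 : x - η - (y - (η + (x - y))) = (2 : ℝ) • (x - y) := by module
  have e3 : y + (η + (x - y)) = x + η := by abel
  have e4 : x - (η + (x - y)) = y - η := by abel
  rw [e1, norm_smul, Real.norm_two] at h1
  rw [e2, norm_smul, Real.norm_two] at h2
  unfold secondDiff
  rw [e3, e4]
  linarith

/-- The one-sided gaps at `η` and `-η` are nonnegative; the left side is the absolute value of their
difference, the right side their sum. This is how the dissipation controls the velocity. -/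
theorem abs_diff_sub_diff_le_of_touching
    (hle : ∀ x' y', f x' - f y' ≤ a + L * ‖x' - y'‖) (heq : f x - f y = a + L * ‖x - y‖)
    (η : Plane) : |(f (x + η) - f (x - η)) - (f (y + η) - f (y - η))| ≤
      2 * (secondDiff f x η - secondDiff f y η) := by
  have h1 := hle (x + η) (y + η)
  have h2 := hle (x - η) (y - η)
  rw [add_sub_add_right_eq_sub] at h1
  rw [sub_sub_sub_cancel_right] at h2
  unfold secondDiff
  rw [abs_le]
  constructor <;> linarith

/-- The bound `a ≤ G(η) + G(η + w)` is integrated over the ball of radius `ξ`, of area `π ξ²`. That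
ball and its translate by `w` lie in `‖η‖ ≤ 2ξ`, where the kernel is at least `(2ξ)^(-2-β)`. -/
theorem integral_gap_ge_of_touching {β : ℝ} (hβ : 0 < β)
    (hc : Continuous f) (hxy : x ≠ y)
    (hle : ∀ x' y', f x' - f y' ≤ a + L * ‖x' - y'‖) (heq : f x - f y = a + L * ‖x - y‖)
    (hint : Integrable fun η => (secondDiff f x η - secondDiff f y η) * ‖η‖ ^ (-2 - β)) :
    Real.pi / 2 * 2 ^ (-2 - β) * ‖x - y‖ ^ (-β) * a ≤
      ∫ η, (secondDiff f x η - secondDiff f y η) * ‖η‖ ^ (-2 - β) := by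
  set ξ := ‖x - y‖
  have hξ : 0 < ξ := norm_pos_iff.2 (sub_ne_zero.2 hxy)
  set w := x - y
  set G : Plane → ℝ := fun η => secondDiff f x η - secondDiff f y η
  have hGc : Continuous G :=
    ((continuous_secondDiff hc).comp (Continuous.prodMk_right x)).sub
      ((continuous_secondDiff hc).comp (Continuous.prodMk_right y))
  have hG0 : ∀ η, 0 ≤ G η := gap_nonneg_of_touching hle heq
  set S := Metric.ball (0 : Plane) ξ
  set k : ℝ := (2 * ξ) ^ (-2 - β)
  have hk0 : 0 ≤ k := by positivity
  have hkey (η : Plane) (hη : ‖η‖ ≤ 2 * ξ) (hη0 : η ≠ 0) : k ≤ ‖η‖ ^ (-2 - β) :=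
    Real.rpow_le_rpow_of_nonpos (norm_pos_iff.2 hη0) hη (by linarith)
  have hne : ∀ᵐ η : Plane, η ≠ 0 := by simp [ae_iff]
  have hSint {g : Plane → ℝ} (hg : Continuous g) : Integrable (S.indicator g) :=
    (integrable_indicator_iff Metric.isOpen_ball.measurableSet).2
      ((hg.continuousOn.integrableOn_compact (isCompact_closedBall (0 : Plane) ξ)).mono_set
        Metric.ball_subset_closedBall)
  have hGw : Continuous fun η => G (η + w) := by fun_prop
  have h1 : k * ∫ η, S.indicator G η ≤ ∫ η, G η * ‖η‖ ^ (-2 - β) := by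
    rw [← integral_const_mul]
    refine integral_mono_ae ((hSint hGc).const_mul k) hint ?_
    filter_upwards [hne] with η hη0
    by_cases hη : η ∈ S
    · rw [indicator_of_mem hη, mul_comm]
      refine mul_le_mul_of_nonneg_left (hkey η ?_ hη0) (hG0 η)
      have := mem_ball_zero_iff.1 hη
      linarith
    · rw [indicator_of_notMem hη, mul_zero]
      exact mul_nonneg (hG0 η) (by positivity)
  have h2 : k * ∫ η, S.indicator (fun η => G (η + w)) η ≤ ∫ η, G η * ‖η‖ ^ (-2 - β) := by
    rw [← integral_sub_right_eq_self _ w, ← integral_const_mul]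
    refine integral_mono_ae (((hSint hGw).comp_sub_right w).const_mul k) hint ?_
    filter_upwards [hne] with η hη0
    by_cases hη : η - w ∈ S
    · rw [indicator_of_mem hη, sub_add_cancel, mul_comm]
      refine mul_le_mul_of_nonneg_left (hkey η ?_ hη0) (hG0 η)
      have := mem_ball_zero_iff.1 hη
      have h3 : ‖η‖ ≤ ‖η - w‖ + ‖w‖ := norm_le_norm_sub_add η w
      linarith [show ‖w‖ = ξ from rfl]
    · rw [indicator_of_notMem hη, mul_zero]
      exact mul_nonneg (hG0 η) (by positivity)
  have h3 : ∫ η, S.indicator (fun _ => a) η ≤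
      (∫ η, S.indicator G η) + ∫ η, S.indicator (fun η => G (η + w)) η := by
    rw [← integral_add (hSint hGc) (hSint hGw)]
    refine integral_mono (hSint continuous_const) ((hSint hGc).add (hSint hGw)) fun η => ?_
    by_cases hη : η ∈ S
    · simp only [indicator_of_mem hη]
      exact le_gap_add_gap_of_touching hle heq η
    · simp [indicator_of_notMem hη]
  have h4 : ∫ η, S.indicator (fun _ => a) η = Real.pi * ξ ^ 2 * a := by
    rw [integral_indicator_const _ Metric.isOpen_ball.measurableSet, Measure.real,
      EuclideanSpace.volume_ball_fin_two, ENNReal.toReal_mul, ENNReal.toReal_pow,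
      ENNReal.toReal_ofReal hξ.le, ENNReal.toReal_ofReal Real.pi_pos.le, smul_eq_mul]
    ring
  have h5 : k * (Real.pi * ξ ^ 2 * a) ≤ 2 * ∫ η, G η * ‖η‖ ^ (-2 - β) := by
    rw [← h4]
    have := mul_le_mul_of_nonneg_left h3 hk0
    linarith
  have h6 : k * ξ ^ 2 = 2 ^ (-2 - β) * ξ ^ (-β) := by
    simp only [k]
    rw [Real.mul_rpow (by norm_num) hξ.le, mul_assoc, ← Real.rpow_natCast, ← Real.rpow_add hξ]
    norm_num
    ring_nf
    simp
  have h7 : k * (Real.pi * ξ ^ 2 * a) = 2 * (Real.pi / 2 * 2 ^ (-2 - β) * ξ ^ (-β) * a) := by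
    linear_combination (Real.pi * a) * h6
  linarith

/-- The integral is split at `‖η‖ = ξ`. Inside, `‖η‖^(β-α) ≤ ξ^(β-α)` converts the velocity kernel
into the dissipation kernel; outside, the gap is at most twice the modulus and the kernel has an
integrable tail. -/
theorem abs_rieszIntegral_sub_le_of_touching {α β : ℝ} (hα : 0 < α) (hαβ : α < β) (hxy : x ≠ y)
    (hle : ∀ x' y', f x' - f y' ≤ a + L * ‖x' - y'‖) (heq : f x - f y = a + L * ‖x - y‖)
    (hint : Integrable fun η => (secondDiff f x η - secondDiff f y η) * ‖η‖ ^ (-2 - β))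
    (j : Fin 2)
    (hr : ∀ z, Integrable fun η : Plane => η j * ‖η‖ ^ (-3 - α) * (f (z + η) - f (z - η))) :
    |rieszIntegral α f j x - rieszIntegral α f j y| ≤ 2 * ‖x - y‖ ^ (β - α) *
      (∫ η, (secondDiff f x η - secondDiff f y η) * ‖η‖ ^ (-2 - β)) +
      4 * (a + L * ‖x - y‖) * (‖x - y‖ ^ (-α) * tailConst α) := by
  set ξ := ‖x - y‖
  have hξ : 0 < ξ := norm_pos_iff.2 (sub_ne_zero.2 hxy)
  have hω : 0 ≤ a + L * ξ := by
    have h1 := gap_nonneg_of_touching hle heq 0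
    have h2 := gap_le_of_touching hle heq 0
    linarith
  have ht := (integrable_tail hα hξ).const_mul (4 * (a + L * ξ))
  rw [rieszIntegral, rieszIntegral, ← integral_sub (hr x) (hr y), ← integral_tail hξ,
    ← integral_const_mul, ← integral_const_mul, ← integral_add (hint.const_mul _) ht,
    ← Real.norm_eq_abs]
  refine norm_integral_le_of_norm_le ((hint.const_mul _).add ht) (Eventually.of_forall fun η => ?_)
  rw [← mul_sub, norm_mul, Real.norm_eq_abs, Real.norm_eq_abs]
  have h1 := abs_coord_mul_rpow_le α η j
  have h2 := abs_diff_sub_diff_le_of_touching hle heq η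
  have h3 := gap_nonneg_of_touching hle heq η
  have h4 : _ ≤ 2 * (a + L * ξ) := gap_le_of_touching hle heq η
  set G := secondDiff f x η - secondDiff f y η
  have h5 := mul_le_mul h1 h2 (abs_nonneg _) (by positivity)
  refine h5.trans ?_
  by_cases hη : ξ < ‖η‖
  · rw [indicator_of_mem (show η ∈ {η : Plane | ξ < ‖η‖} from hη)]
    have h6 : 0 ≤ 2 * ξ ^ (β - α) * (G * ‖η‖ ^ (-2 - β)) := by positivity
    have h7 : ‖η‖ ^ (-2 - α) * (2 * G) ≤ ‖η‖ ^ (-2 - α) * (4 * (a + L * ξ)) := by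
      exact mul_le_mul_of_nonneg_left (by linarith) (by positivity)
    linarith
  · rw [indicator_of_notMem (show η ∉ {η : Plane | ξ < ‖η‖} from hη), mul_zero,
      add_zero]
    rcases eq_or_ne η 0 with rfl | hη0
    · rw [norm_zero, Real.zero_rpow (by linarith), zero_mul]
      positivity
    have hn : 0 < ‖η‖ := norm_pos_iff.2 hη0
    have h6 : ‖η‖ ^ (-2 - α) = ‖η‖ ^ (β - α) * ‖η‖ ^ (-2 - β) := by
      rw [← Real.rpow_add hn]; ring_nf
    have h7 : ‖η‖ ^ (β - α) ≤ ξ ^ (β - α) :=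
      Real.rpow_le_rpow hn.le (not_lt.1 hη) (by linarith)
    rw [h6]
    calc ‖η‖ ^ (β - α) * ‖η‖ ^ (-2 - β) * (2 * G)
        ≤ ξ ^ (β - α) * ‖η‖ ^ (-2 - β) * (2 * G) := by gcongr
      _ = _ := by ring

end Touching

/-! ### The modulus of continuity -/

/-- The tangent line of `s ↦ s ^ γ` at `r`. -/
noncomputable def powTangent (γ r s : ℝ) : ℝ := γ * r ^ (γ - 1) * s + (1 - γ) * r ^ γ

theorem powTangent_self {γ r : ℝ} (hr : 0 < r) : powTangent γ r r = r ^ γ := by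
  have h1 : r ^ (γ - 1) * r = r ^ γ := by
    rw [Real.rpow_sub_one hr.ne']; field_simp
  rw [powTangent, mul_assoc, h1]; ring

/-- Weighted AM–GM for `s` and `r`, multiplied by `r^(γ-1)`. -/
theorem rpow_le_powTangent {γ r s : ℝ} (hγ : 0 < γ) (hγ1 : γ < 1) (hr : 0 < r) (hs : 0 ≤ s) :
    s ^ γ ≤ powTangent γ r s := by
  have h1 := Real.geom_mean_le_arith_mean2_weighted hγ.le (sub_nonneg.2 hγ1.le) hs hr.le (by ring)
  have h2 : 0 < r ^ (γ - 1) := Real.rpow_pos_of_pos hr _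
  have h3 : r ^ (1 - γ) * r ^ (γ - 1) = 1 := by rw [← Real.rpow_add hr]; norm_num
  have h4 : r * r ^ (γ - 1) = r ^ γ := by rw [Real.rpow_sub_one hr.ne']; field_simp
  calc s ^ γ = s ^ γ * r ^ (1 - γ) * r ^ (γ - 1) := by rw [mul_assoc, h3, mul_one]
    _ ≤ (γ * s + (1 - γ) * r) * r ^ (γ - 1) := by gcongr
    _ = powTangent γ r s := by rw [powTangent, ← h4]; ring

/-- At `z` the tangent at `r` is at least as high as the tangent at `z`, and its slope is no larger,
so it also stays above to the left of `z`. -/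
theorem powTangent_le_powTangent {γ z r s : ℝ} (hγ : 0 < γ) (hγ1 : γ < 1) (hz : 0 < z)
    (hzr : z ≤ r) (hsz : s ≤ z) : powTangent γ z s ≤ powTangent γ r s := by
  have h1 := rpow_le_powTangent hγ hγ1 (hz.trans_le hzr) hz.le
  rw [← powTangent_self hz] at h1
  have h2 : r ^ (γ - 1) ≤ z ^ (γ - 1) := Real.rpow_le_rpow_of_nonpos hz hzr (by linarith)
  have h3 : γ * r ^ (γ - 1) * (z - s) ≤ γ * z ^ (γ - 1) * (z - s) := by
    have := sub_nonneg.2 hsz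
    gcongr
  unfold powTangent at *
  nlinarith

theorem hasDerivAt_powTangent {γ z : ℝ} (hz : 0 < z) (s : ℝ) :
    HasDerivAt (fun z => powTangent γ z s) (γ * (1 - γ) * z ^ (γ - 2) * (z - s)) z := by
  have h1 := ((Real.hasDerivAt_rpow_const (p := γ - 1) (Or.inl hz.ne')).const_mul γ).mul_const s
  have h2 := (Real.hasDerivAt_rpow_const (p := γ) (Or.inl hz.ne')).const_mul (1 - γ)
  refine (h1.add h2).congr_deriv ?_
  have h3 : z ^ (γ - 1) = z ^ (γ - 2) * z := by
    rw [show γ - 1 = γ - 2 + 1 by ring, Real.rpow_add_one hz.ne']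
  rw [show γ - 1 - 1 = γ - 2 by ring, h3]
  ring

section Modulus

variable {γ H δ z ξ : ℝ}

/-- The linear and the power branch become one expression: the tangent line at `max ξ z`, evaluated
at `ξ`. -/
theorem evtModulus_of_le (hδ : 0 < δ) (hz : 0 < z) (hξδ : ξ ≤ δ) :
    evtModulus γ H δ z ξ = H * δ ^ (-γ) * powTangent γ (max ξ z) ξ := by
  unfold evtModulus
  split_ifs with h
  · rw [max_eq_right h, powTangent]; ring
  · have h' := not_le.1 h
    rw [max_eq_left h'.le, powTangent_self (hz.trans h'), Real.rpow_neg hδ.le, div_eq_mul_inv]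

theorem evtModulus_of_ge (hδ : 0 < δ) (hz : 0 < z) (hzδ : z ≤ δ) (hξδ : δ ≤ ξ) :
    evtModulus γ H δ z ξ = H := by
  rcases hξδ.eq_or_lt with rfl | h
  · rw [evtModulus_of_le hδ hz le_rfl, max_eq_left hzδ, powTangent_self hδ, mul_assoc,
      ← Real.rpow_add hδ]
    simp
  · rw [evtModulus, if_neg (by linarith), if_neg (by linarith)]

/-- Truncating at `δ` includes the flat branch and makes joint continuity in `ξ` and `z` visible. -/
theorem evtModulus_eq (hδ : 0 < δ) (hz : 0 < z) (hzδ : z ≤ δ) (ξ : ℝ) :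
    evtModulus γ H δ z ξ = H * δ ^ (-γ) * powTangent γ (max (min ξ δ) z) (min ξ δ) := by
  rcases le_total ξ δ with h | h
  · rw [min_eq_left h, evtModulus_of_le hδ hz h]
  · rw [min_eq_right h, evtModulus_of_ge hδ hz hzδ h, ← evtModulus_of_le hδ hz le_rfl,
      evtModulus_of_ge hδ hz hzδ le_rfl]

/-- At a contact at distance `ξ ≤ δ`, the choice `r = max ξ z` turns this into an equality there;
this supplies the affine comparison function. -/
theorem evtModulus_le_powTangent (hγ : 0 < γ) (hγ1 : γ < 1) (hH : 0 < H) (hδ : 0 < δ) (hz : 0 < z)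
    (hzδ : z ≤ δ) {r : ℝ} (hzr : z ≤ r) (hξ : 0 ≤ ξ) :
    evtModulus γ H δ z ξ ≤ H * δ ^ (-γ) * powTangent γ r ξ := by
  have hr : 0 < r := hz.trans_le hzr
  have hmain (s : ℝ) (hs : 0 ≤ s) : powTangent γ (max s z) s ≤ powTangent γ r s := by
    rcases le_total s z with h | h
    · rw [max_eq_right h]
      exact powTangent_le_powTangent hγ hγ1 hz hzr h
    · rw [max_eq_left h, powTangent_self (hz.trans_le h)]
      exact rpow_le_powTangent hγ hγ1 hr hs
  rw [evtModulus_eq hδ hz hzδ]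
  refine mul_le_mul_of_nonneg_left ((hmain _ (le_min hξ hδ.le)).trans ?_) (by positivity)
  unfold powTangent
  gcongr
  exact min_le_left _ _

/-- As `ξ₀` decreases in time, its final value `z'` gives a lower bound valid at all earlier times
and all distances. -/
theorem le_evtModulus (hγ : 0 < γ) (hγ1 : γ < 1) (hH : 0 < H) (hδ : 0 < δ) (hz : 0 < z)
    (hzδ : z ≤ δ) {z' : ℝ} (hz' : 0 < z') (hzz : z' ≤ z) (hξ : 0 ≤ ξ) :
    H * δ ^ (-γ) * ((1 - γ) * z' ^ γ) ≤ evtModulus γ H δ z ξ := by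
  rw [evtModulus_eq hδ hz hzδ]
  refine mul_le_mul_of_nonneg_left ?_ (by positivity)
  have h1 : z' ^ γ ≤ (max (min ξ δ) z) ^ γ :=
    Real.rpow_le_rpow hz'.le (hzz.trans (le_max_right _ _)) hγ.le
  have h2 : 0 ≤ γ * (max (min ξ δ) z) ^ (γ - 1) * min ξ δ := by
    have := le_min hξ hδ.le
    have : 0 ≤ max (min ξ δ) z := hz.le.trans (le_max_right _ _)
    positivity
  unfold powTangent
  nlinarith

end Modulus

/-! ### The constants and the strict inequality at a touching point -/

/-- The constant in the lower bound of the dissipation at a touching point. -/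
noncomputable def dissConst (β : ℝ) : ℝ := Real.pi / 2 * 2 ^ (-2 - β)

theorem dissConst_pos (β : ℝ) : 0 < dissConst β := by unfold dissConst; positivity

/-- The constant of the nonlinear term at a touching point. -/
noncomputable def nonlinConst (α β γ : ℝ) : ℝ :=
  γ / rieszConst α * (2 + 4 * tailConst α / (dissConst β * (1 - γ)))

theorem nonlinConst_pos {α β γ : ℝ} (hα : 0 < α) (hα1 : α < 1) (hγ : 0 < γ) (hγ1 : γ < 1) :
    0 < nonlinConst α β γ := by
  have h1 := rieszConst_pos hα hα1
  have h2 := tailConst_nonneg α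
  have h3 := dissConst_pos β
  have h4 := sub_pos.2 hγ1
  unfold nonlinConst
  positivity

/-- In the difference of the equations at `x` and `y`, the common gradient leaves only the velocity
increment in the transport term. Half of the dissipation absorbs it; the right side is the lower
bound for the other half. -/
theorem IsGlobalSmoothSolution.deriv_sub_deriv_le_of_touching {α β ν ε m : ℝ} {θ₀ : Plane → ℝ}
    {θ : ℝ → Plane → ℝ} (h : IsGlobalSmoothSolution α β ν ε m θ₀ θ) (hα : 0 < α)
    (hα1 : α < 1) (hαβ : α < β) (hβ2 : β < 2) (hε : 0 < ε) (hm : 2 < m)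
    (hc : Continuous θ₀) {t : ℝ} (ht : 0 < t) {γ A r C : ℝ} (hγ : 0 < γ) (hγ1 : γ < 1) (hA : 0 < A)
    {x y : Plane} (hxy : x ≠ y) (hr : ‖x - y‖ ≤ r) (hC : A * r ^ (γ - 1 + β - α) ≤ C)
    (hCν : C * nonlinConst α β γ ≤ ν / (2 * fracConst β))
    (hle : ∀ x' y', θ t x' - θ t y' ≤ A * powTangent γ r ‖x' - y'‖)
    (heq : θ t x - θ t y = A * powTangent γ r ‖x - y‖) :
    deriv (fun s => θ s x) t - deriv (fun s => θ s y) t ≤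
      -(ν / (2 * fracConst β) * (dissConst β * ‖x - y‖ ^ (-β) * (A * (1 - γ) * r ^ γ))) := by
  have hβ : 0 < β := hα.trans hαβ
  have hξ : 0 < ‖x - y‖ := norm_pos_iff.2 (sub_ne_zero.2 hxy)
  set ξ := ‖x - y‖ with hξdef
  have hr0 : 0 < r := hξ.trans_le hr
  set a := A * (1 - γ) * r ^ γ with ha
  set L := A * γ * r ^ (γ - 1) with hLdef
  have h1γ := sub_pos.2 hγ1
  have ha0 : 0 < a := by positivity
  have hL0 : 0 < L := by positivity
  have hform (s : ℝ) : A * powTangent γ r s = a + L * s := by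
    rw [ha, hLdef, powTangent]; ring
  simp only [hform] at hle heq
  have hf := h.contDiff_slice ht
  have hd : Differentiable ℝ (θ t) := hf.differentiable (by norm_num)
  obtain ⟨B, hB⟩ := h.exists_bound hm hc ht.le
  obtain ⟨hint, hpde⟩ := h.pointwise_equation hα hα1 hβ hβ2 hm hc ht
  have hshift (η : Plane) : θ t (x + η) - θ t (y + η) ≤ θ t x - θ t y := by
    have := hle (x + η) (y + η)
    rw [add_sub_add_right_eq_sub] at this
    linarith
  have hgrad := gradient_eq_of_isMax_sub hd hshift
  have hlap := laplacian_le_of_isMax_sub hf hshift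
  have hgL := norm_gradient_le_of_touching hd hL0.le hle heq
  have hKx := integrable_secondDiff_mul hβ hβ2 hf hB x
  have hKy := integrable_secondDiff_mul hβ hβ2 hf hB y
  have hGint : Integrable fun η : Plane =>
      (secondDiff (θ t) x η - secondDiff (θ t) y η) * ‖η‖ ^ (-2 - β) := by
    simp only [sub_mul]
    exact hKx.sub hKy
  set D := ∫ η : Plane, (secondDiff (θ t) x η - secondDiff (θ t) y η) * ‖η‖ ^ (-2 - β) with hDdef
  have hfrac : fracLap β (θ t) x - fracLap β (θ t) y = (fracConst β)⁻¹ * D := by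
    simp only [fracLap, hDdef, sub_mul]
    rw [integral_sub hKx hKy]
    ring
  have hD : dissConst β * ξ ^ (-β) * a ≤ D :=
    integral_gap_ge_of_touching hβ hf.continuous hxy hle heq hGint
  have hk := dissConst_pos β
  have hD0 : 0 < D := lt_of_lt_of_le (by positivity) hD
  have hR (j : Fin 2) := abs_rieszIntegral_sub_le_of_touching hα hαβ hxy hle heq hGint j (hint j)
  have hJ := tailConst_nonneg α
  have hcα := rieszConst_pos hα hα1
  have hFβ := fracConst_pos hβ hβ2
  -- the velocity increment is bounded by the dissipation
  have hω : a + L * ξ ≤ A * r ^ γ := by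
    have h1 : L * ξ ≤ L * r := by gcongr
    have h2 : L * r = A * γ * r ^ γ := by
      rw [hLdef, mul_assoc, ← Real.rpow_add_one hr0.ne', sub_add_cancel]
    rw [ha]
    linarith
  have hξr : (a + L * ξ) * ξ ^ (-α) ≤ ξ ^ (β - α) * (D / (dissConst β * (1 - γ))) := by
    have h1 : ξ ^ (-α) = ξ ^ (β - α) * ξ ^ (-β) := by
      rw [← Real.rpow_add hξ]; ring_nf
    have h2 : A * r ^ γ * ξ ^ (-β) ≤ D / (dissConst β * (1 - γ)) := by
      rw [le_div_iff₀ (by positivity)]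
      refine le_trans (le_of_eq ?_) hD
      rw [ha]; ring
    calc (a + L * ξ) * ξ ^ (-α) ≤ A * r ^ γ * ξ ^ (-α) := by gcongr
      _ = ξ ^ (β - α) * (A * r ^ γ * ξ ^ (-β)) := by rw [h1]; ring
      _ ≤ _ := by gcongr
  set N := 2 + 4 * tailConst α / (dissConst β * (1 - γ)) with hN
  have hN0 : 0 < N := by positivity
  have hRN (j : Fin 2) : |rieszIntegral α (θ t) j x - rieszIntegral α (θ t) j y| ≤
      ξ ^ (β - α) * N * D := by
    refine (hR j).trans ?_
    have h1 := mul_le_mul_of_nonneg_left hξr (by positivity : 0 ≤ 4 * tailConst α)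
    have h2 : ξ ^ (β - α) * N * D = 2 * ξ ^ (β - α) * D +
        4 * tailConst α * (ξ ^ (β - α) * (D / (dissConst β * (1 - γ)))) := by
      rw [hN]; ring
    rw [h2]
    linarith
  -- The smallness constant enters here: `ξ ≤ r` and `β > α` turn the slope times `ξ^(β-α)` into the
  -- scale-dependent amplitude bounded by `C`.
  have hLξ : L * ξ ^ (β - α) ≤ γ * C := by
    have h1 : ξ ^ (β - α) ≤ r ^ (β - α) := Real.rpow_le_rpow hξ.le hr (by linarith)
    calc L * ξ ^ (β - α) ≤ L * r ^ (β - α) := by gcongr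
      _ = γ * (A * r ^ (γ - 1 + β - α)) := by
        rw [show γ - 1 + β - α = γ - 1 + (β - α) by ring, Real.rpow_add hr0, hLdef]; ring
      _ ≤ γ * C := by gcongr
  set p := gradient (θ t) x with hp
  have hpj (j : Fin 2) : |p j| ≤ L := by
    refine le_trans ?_ hgL
    simpa using PiLp.norm_apply_le p j
  have hprod (i j : Fin 2) : |(rieszIntegral α (θ t) i x - rieszIntegral α (θ t) i y) * p j| ≤
      ξ ^ (β - α) * N * D * L := by
    rw [abs_mul]
    exact mul_le_mul (hRN i) (hpj j) (abs_nonneg _) (by positivity)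
  have h10 := (abs_le.1 (hprod 1 0)).1
  have h01 := (abs_le.1 (hprod 0 1)).2
  have hnl : 1 / (2 * rieszConst α) * (2 * (ξ ^ (β - α) * N * D * L)) ≤
      ν / (2 * fracConst β) * D := by
    have h1 : 1 / (2 * rieszConst α) * (2 * (ξ ^ (β - α) * N * D * L)) =
        (L * ξ ^ (β - α)) * (N / rieszConst α * D) := by field_simp
    have h2 : (γ * C) * (N / rieszConst α * D) = C * nonlinConst α β γ * D := by
      rw [nonlinConst, ← hN]; ring
    rw [h1]
    refine (mul_le_mul_of_nonneg_right hLξ (by positivity)).trans ?_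
    rw [h2]
    gcongr
  have hx := hpde x
  have hy := hpde y
  rw [← hgrad] at hy
  have hinc : -(1 / (2 * rieszConst α) * ((rieszIntegral α (θ t) 1 x - rieszIntegral α (θ t) 1 y) * p 0
      - (rieszIntegral α (θ t) 0 x - rieszIntegral α (θ t) 0 y) * p 1)) ≤
      1 / (2 * rieszConst α) * (2 * (ξ ^ (β - α) * N * D * L)) := by
    rw [← mul_neg]
    refine mul_le_mul_of_nonneg_left ?_ (by positivity)
    linarith
  have hlapε := mul_nonneg hε.le (sub_nonneg.2 hlap)
  have hsum : deriv (fun s => θ s x) t - deriv (fun s => θ s y) t =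
      -(1 / (2 * rieszConst α) * ((rieszIntegral α (θ t) 1 x - rieszIntegral α (θ t) 1 y) * p 0
      - (rieszIntegral α (θ t) 0 x - rieszIntegral α (θ t) 0 y) * p 1))
      - ν * ((fracConst β)⁻¹ * D)
      - ε * (Laplacian.laplacian (θ t) y - Laplacian.laplacian (θ t) x) := by
    rw [← hfrac]
    linear_combination hx - hy
  have hνD : ν * ((fracConst β)⁻¹ * D) = 2 * (ν / (2 * fracConst β) * D) := by field_simp
  have hCpos : 0 ≤ ν / (2 * fracConst β) := by
    refine le_trans (mul_nonneg ?_ (nonlinConst_pos hα hα1 hγ hγ1).le) hCν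
    exact le_trans (by positivity) hC
  have hfin := mul_le_mul_of_nonneg_left hD hCpos
  linarith

/-! ### Propagation of the modulus in time -/

theorem abs_le_of_eLpNorm_top_le {f : Plane → ℝ} (hf : Continuous f) {c H : ℝ} (hc : 0 < c)
    (hH : 0 ≤ H) (h : ENNReal.ofReal c * eLpNorm f ∞ volume ≤ ENNReal.ofReal H) (x : Plane) :
    |f x| ≤ H / c := by
  have h1 : eLpNorm f ∞ volume ≤ ENNReal.ofReal (H / c) := by
    rw [ENNReal.ofReal_div_of_pos hc]
    rwa [ENNReal.le_div_iff_mul_le (Or.inl (by simpa using hc)) (Or.inl ENNReal.ofReal_ne_top),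
      mul_comm]
  have h2 : ∀ᵐ x, |f x| ≤ H / c := by
    rw [eLpNorm_exponent_top] at h1
    filter_upwards [ae_le_eLpNormEssSup (f := f) (μ := volume)] with x hx
    have h3 := hx.trans h1
    rw [← ofReal_norm, ENNReal.ofReal_le_ofReal_iff (by positivity)] at h3
    exact h3
  by_contra! hcon
  have ho : IsOpen {x | H / c < |f x|} := isOpen_lt continuous_const hf.abs
  refine (ho.measure_pos volume ⟨x, hcon⟩).ne' ?_
  rw [ae_iff] at h2
  simpa using h2

/-- The gap between the increments of `θ` and the modulus is continuous. -/
theorem continuousOn_sub_evtModulus {γ H δ T : ℝ} (hδ : 0 < δ) {θ : ℝ → Plane → ℝ} {ξ₀ : ℝ → ℝ}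
    (hθ : ContinuousOn (fun p : ℝ × Plane => θ p.1 p.2) (Ici 0 ×ˢ univ))
    (hξ : ContinuousOn ξ₀ (Icc 0 T)) (hpos : ∀ t ∈ Icc 0 T, 0 < ξ₀ t)
    (hle : ∀ t ∈ Icc 0 T, ξ₀ t ≤ δ) :
    ContinuousOn (fun p : ℝ × (Plane × Plane) =>
      θ p.1 p.2.1 - θ p.1 p.2.2 - evtModulus γ H δ (ξ₀ p.1) ‖p.2.1 - p.2.2‖)
      (Icc 0 T ×ˢ univ) := by
  have h1 : ContinuousOn (fun p : ℝ × (Plane × Plane) => θ p.1 p.2.1) (Icc 0 T ×ˢ univ) :=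
    hθ.comp (f := fun p : ℝ × (Plane × Plane) => (p.1, p.2.1)) (by fun_prop)
      fun p hp => ⟨hp.1.1, mem_univ _⟩
  have h2 : ContinuousOn (fun p : ℝ × (Plane × Plane) => θ p.1 p.2.2) (Icc 0 T ×ˢ univ) :=
    hθ.comp (f := fun p : ℝ × (Plane × Plane) => (p.1, p.2.2)) (by fun_prop)
      fun p hp => ⟨hp.1.1, mem_univ _⟩
  have h3 : ContinuousOn (fun p : ℝ × (Plane × Plane) => ξ₀ p.1) (Icc 0 T ×ˢ univ) :=
    hξ.comp continuousOn_fst fun p hp => hp.1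
  have h4 : ContinuousOn (fun p : ℝ × (Plane × Plane) => min ‖p.2.1 - p.2.2‖ δ)
      (Icc 0 T ×ˢ univ) := Continuous.continuousOn (by fun_prop)
  have h5 : ContinuousOn (fun p : ℝ × (Plane × Plane) =>
      max (min ‖p.2.1 - p.2.2‖ δ) (ξ₀ p.1)) (Icc 0 T ×ˢ univ) := h4.sup h3
  have hne : ∀ p ∈ (Icc 0 T ×ˢ univ : Set (ℝ × (Plane × Plane))),
      max (min ‖p.2.1 - p.2.2‖ δ) (ξ₀ p.1) ≠ 0 := fun p hp =>
    ((hpos p.1 hp.1).trans_le (le_max_right _ _)).ne'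
  have h6 : ContinuousOn (fun p : ℝ × (Plane × Plane) => H * δ ^ (-γ) *
      powTangent γ (max (min ‖p.2.1 - p.2.2‖ δ) (ξ₀ p.1)) (min ‖p.2.1 - p.2.2‖ δ))
      (Icc 0 T ×ˢ univ) := by
    unfold powTangent
    exact continuousOn_const.mul (((continuousOn_const.mul
      (h5.rpow_const fun p hp => Or.inl (hne p hp))).mul h4).add
      (continuousOn_const.mul (h5.rpow_const fun p hp => Or.inl (hne p hp))))
  refine ((h1.sub h2).sub h6).congr fun p hp => ?_
  rw [evtModulus_eq hδ (hpos p.1 hp.1) (hle p.1 hp.1)]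
  rfl

/-- The left time derivative of the gap at a touching point is negative. -/
theorem exists_neg_hasDerivWithinAt_of_touching {α β ν ε m : ℝ} {θ₀ : Plane → ℝ}
    {θ : ℝ → Plane → ℝ} (h : IsGlobalSmoothSolution α β ν ε m θ₀ θ) (hα : 0 < α)
    (hα1 : α < 1) (hαβ : α < β) (hβ2 : β < 2) (hν : 0 < ν) (hε : 0 < ε) (hm : 2 < m)
    (hc : Continuous θ₀) {γ H δ C₂ t : ℝ} {ξ₀ : ℝ → ℝ} (hγ : 0 < γ) (hγ1 : γ < 1)
    (hαγ : α + 1 - β < γ) (hH : 0 < H) (hδ : 0 < δ)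
    (hHδ : H * nonlinConst α β γ ≤ ν / (2 * fracConst β) * δ ^ (α + 1 - β))
    (hC₂ : C₂ * γ < ν / (2 * fracConst β) * dissConst β) (hC₂0 : 0 ≤ C₂) (ht : 0 < t)
    (hpos : ∀ s ∈ Icc 0 t, 0 < ξ₀ s) (hanti : ∀ s ∈ Icc 0 t, ξ₀ t ≤ ξ₀ s) (hle : ξ₀ t ≤ δ)
    (hξ₀ : HasDerivAt ξ₀ (-C₂ * ξ₀ t ^ (1 - β)) t) {x y : Plane} (hxy : x ≠ y)
    (hxyδ : ‖x - y‖ ≤ δ) (heq : θ t x - θ t y = evtModulus γ H δ (ξ₀ t) ‖x - y‖)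
    (hmax : ∀ x' y', θ t x' - θ t y' ≤ evtModulus γ H δ (ξ₀ t) ‖x' - y'‖) :
    ∃ d < 0, HasDerivWithinAt
      (fun s => θ s x - θ s y - evtModulus γ H δ (ξ₀ s) ‖x - y‖) d (Iic t) t := by
  have htt : t ∈ Icc 0 t := ⟨ht.le, le_rfl⟩
  set z := ξ₀ t with hz
  have hz0 : 0 < z := hpos t htt
  set ξ := ‖x - y‖ with hξdef
  have hξ : 0 < ξ := norm_pos_iff.2 (sub_ne_zero.2 hxy)
  set A := H * δ ^ (-γ) with hA
  have hA0 : 0 < A := by positivity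
  have h1γ := sub_pos.2 hγ1
  set r := max ξ z
  have hr0 : 0 < r := hξ.trans_le (le_max_left _ _)
  have hrδ : r ≤ δ := max_le hxyδ hle
  have hFβ := fracConst_pos (hα.trans hαβ) hβ2
  have hk := dissConst_pos β
  have hN := nonlinConst_pos (β := β) hα hα1 hγ hγ1
  -- Since `γ > α + 1 - β`, the exponent is positive, so the worst scale is `r = δ`.
  have hAr : A * r ^ (γ - 1 + β - α) ≤ H * δ ^ (β - α - 1) := by
    have h1 : r ^ (γ - 1 + β - α) ≤ δ ^ (γ - 1 + β - α) :=
      Real.rpow_le_rpow hr0.le hrδ (by linarith)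
    have h2 : δ ^ (β - α - 1) = δ ^ (-γ) * δ ^ (γ - 1 + β - α) := by
      rw [← Real.rpow_add hδ]; ring_nf
    rw [h2, hA, ← mul_assoc]
    gcongr
  have hCN : H * δ ^ (β - α - 1) * nonlinConst α β γ ≤ ν / (2 * fracConst β) := by
    have h1 : δ ^ (α + 1 - β) * δ ^ (β - α - 1) = 1 := by
      rw [← Real.rpow_add hδ]; ring_nf; simp
    have h2 := mul_le_mul_of_nonneg_right hHδ (by positivity : 0 ≤ δ ^ (β - α - 1))
    rw [mul_assoc (ν / (2 * fracConst β)), h1] at h2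
    linarith
  have hdec := h.deriv_sub_deriv_le_of_touching hα hα1 hαβ hβ2 hε hm hc ht hγ hγ1 hA0 hxy
    (le_max_left ξ z) hAr hCN
    (fun x' y' => (hmax x' y').trans (evtModulus_le_powTangent hγ hγ1 hH hδ hz0 hle
      (le_max_right _ _) (norm_nonneg _)))
    (by rw [heq, evtModulus_of_le hδ hz0 hxyδ])
  set d₀ := deriv (fun s => θ s x) t - deriv (fun s => θ s y) t
  have hder : HasDerivAt (fun s => θ s x - θ s y) d₀ t :=
    (h.hasDerivAt ht x).differentiableAt.hasDerivAt.sub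
      (h.hasDerivAt ht y).differentiableAt.hasDerivAt
  -- For `ξ ≤ z` the pair lies on the tangent branch at all earlier times, as `ξ₀` is nonincreasing,
  -- and the modulus moves with `ξ₀`. For `ξ > z` it lies on the power branch just before `t`, and
  -- the modulus is stationary.
  rcases le_or_gt ξ z with hξz | hξz
  · have hT := (hasDerivAt_powTangent (γ := γ) hz0 ξ).comp t hξ₀
    refine ⟨_, ?_, (hder.sub (hT.const_mul A)).hasDerivWithinAt.congr_of_eventuallyEq ?_ ?_⟩
    · rw [max_eq_right hξz, ← hξdef] at hdec
      have hzβ : z ^ (-β) ≤ ξ ^ (-β) := Real.rpow_le_rpow_of_nonpos hξ hξz (by linarith)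
      have e1 : z ^ (γ - 2) * z ^ (1 - β) * z = z ^ (-β) * z ^ γ := by
        rw [← Real.rpow_add hz0, ← Real.rpow_add_one hz0.ne', ← Real.rpow_add hz0]; ring_nf
      -- Speed of the modulus: `z - ξ ≤ z`, and the power `1 - β` in the equation for `ξ₀` makes it
      -- scale like the dissipation `z^(-β) z^γ`.
      have h2 : C₂ * γ * (A * (1 - γ)) * (z ^ (γ - 2) * z ^ (1 - β) * (z - ξ)) ≤
          C₂ * γ * (A * (1 - γ)) * (z ^ (-β) * z ^ γ) := by
        rw [← e1]
        gcongr
        linarith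
      have h3 : C₂ * γ * (A * (1 - γ)) * (z ^ (-β) * z ^ γ) <
          ν / (2 * fracConst β) * dissConst β * (A * (1 - γ)) * (z ^ (-β) * z ^ γ) := by
        gcongr
      have h4 : ν / (2 * fracConst β) * dissConst β * (A * (1 - γ)) * (z ^ (-β) * z ^ γ) ≤
          ν / (2 * fracConst β) * dissConst β * (A * (1 - γ)) * (ξ ^ (-β) * z ^ γ) := by
        gcongr
      linarith
    · filter_upwards [Ioc_mem_nhdsLE ht] with s hs
      have hs' : s ∈ Icc 0 t := ⟨hs.1.le, hs.2⟩
      have h5 := hanti s hs'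
      simp only [Pi.sub_apply, Function.comp_apply]
      rw [evtModulus_of_le hδ (hpos s hs') hxyδ, max_eq_right (hξz.trans h5)]
    · simp only [Pi.sub_apply, Function.comp_apply]
      rw [evtModulus_of_le hδ (hpos t htt) hxyδ, max_eq_right hξz]
  · refine ⟨d₀, lt_of_le_of_lt hdec (neg_lt_zero.2 (by positivity)),
      (hder.sub_const (A * ξ ^ γ)).hasDerivWithinAt.congr_of_eventuallyEq ?_ ?_⟩
    · have hev : ∀ᶠ s in 𝓝[≤] t, ξ₀ s < ξ :=
        (hξ₀.continuousAt.eventually_lt_const hξz).filter_mono nhdsWithin_le_nhds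
      filter_upwards [hev, Ioc_mem_nhdsLE ht] with s hs hst
      rw [evtModulus_of_le hδ (hpos s ⟨hst.1.le, hst.2⟩) hxyδ, max_eq_left hs.le,
        powTangent_self hξ]
    · rw [evtModulus_of_le hδ (hpos t htt) hxyδ, max_eq_left hξz.le, powTangent_self hξ]

/-- The first-touching principle is applied to pairs of points, on `[0, t]` for each `t < T`, so
that `ξ₀` stays bounded below by a positive number. -/
theorem obeysModulus_of_constants {α β ν ε m : ℝ} {θ₀ : Plane → ℝ}
    {θ : ℝ → Plane → ℝ} (h : IsGlobalSmoothSolution α β ν ε m θ₀ θ) (hα : 0 < α)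
    (hα1 : α < 1) (hαβ : α < β) (hβ2 : β < 2) (hν : 0 < ν) (hε : 0 < ε) (hm : 2 < m)
    (hc : Continuous θ₀) {γ H δ C₂ M T : ℝ} {ξ₀ : ℝ → ℝ} (hγ : 0 < γ) (hγ1 : γ < 1)
    (hαγ : α + 1 - β < γ) (hH : 0 < H) (hδ : 0 < δ)
    (hHδ : H * nonlinConst α β γ ≤ ν / (2 * fracConst β) * δ ^ (α + 1 - β))
    (hC₂ : C₂ * γ < ν / (2 * fracConst β) * dissConst β) (hC₂0 : 0 ≤ C₂)
    (hM : ∀ x, |θ₀ x| ≤ M) (hMH : 2 * M < H) (hobey : ObeysModulus θ₀ (evtModulus γ H δ δ))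
    (hξ0 : ξ₀ 0 = δ) (hpos : ∀ t ∈ Ico 0 T, 0 < ξ₀ t)
    (hξ₀ : ∀ t ∈ Ico 0 T, HasDerivWithinAt ξ₀ (-C₂ * ξ₀ t ^ (1 - β)) (Ico 0 T) t) :
    ∀ t ∈ Ico 0 T, ObeysModulus (θ t) (evtModulus γ H δ (ξ₀ t)) := by
  intro t ht
  have hsub : Icc 0 t ⊆ Ico 0 T := fun s hs => ⟨hs.1, hs.2.trans_lt ht.2⟩
  have hcont : ContinuousOn ξ₀ (Ico 0 T) := fun s hs => (hξ₀ s hs).continuousWithinAt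
  have hanti : AntitoneOn ξ₀ (Ico 0 T) := by
    refine antitoneOn_of_hasDerivWithinAt_nonpos (f' := fun s => -C₂ * ξ₀ s ^ (1 - β))
      (convex_Ico 0 T) hcont (fun s hs => (hξ₀ s (interior_subset hs)).mono interior_subset)
      fun s hs => ?_
    have := hpos s (interior_subset hs)
    have h1 : 0 ≤ C₂ * ξ₀ s ^ (1 - β) := by positivity
    linarith
  have hT : (0 : ℝ) ∈ Ico 0 T := ⟨le_rfl, ht.1.trans_lt ht.2⟩
  have hle (s : ℝ) (hs : s ∈ Icc 0 t) : ξ₀ s ≤ δ := hξ0 ▸ hanti hT (hsub hs) hs.1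
  have hbd (s : ℝ) (hs : s ∈ Icc 0 t) (x y : Plane) : θ s x - θ s y < H := by
    have h1 := h.abs_le_of_initial_le hα hα1 (hα.trans hαβ) hβ2 hν hε hm hc hM hs.1
    have h2 := (abs_le.1 (h1 x)).2
    have h3 := (abs_le.1 (h1 y)).1
    linarith
  have htt : t ∈ Icc 0 t := ⟨ht.1, le_rfl⟩
  have h1γ := sub_pos.2 hγ1
  set z := ξ₀ t
  have hz : 0 < z := hpos t ht
  set κ := H * δ ^ (-γ) * ((1 - γ) * z ^ γ) with hκdef
  have hκ : 0 < κ := by positivity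
  have hlow (s : ℝ) (hs : s ∈ Icc 0 t) (ξ : ℝ) (hξ : 0 ≤ ξ) :
      κ ≤ evtModulus γ H δ (ξ₀ s) ξ :=
    le_evtModulus hγ hγ1 hH hδ (hpos s (hsub hs)) (hle s hs) hz (hanti (hsub hs) ht hs.2) hξ
  -- If both points lie outside radius `R`, the increment is below `κ`, hence below the modulus; as
  -- the points are closer than `δ`, both then lie within `R + δ`.
  obtain ⟨R, hR⟩ := h.exists_decay_radius hm hc t (half_pos hκ)
  have hnear (s : ℝ) (hs : s ∈ Icc 0 t) (x y : Plane)
      (hxy : 0 ≤ θ s x - θ s y - evtModulus γ H δ (ξ₀ s) ‖x - y‖) : ‖x - y‖ < δ := by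
    by_contra! hcon
    rw [evtModulus_of_ge hδ (hpos s (hsub hs)) (hle s hs) hcon] at hxy
    linarith [hbd s hs x y]
  have hmain := neg_of_first_touching (T := t)
    (Φ := fun s (p : Plane × Plane) =>
      θ s p.1 - θ s p.2 - evtModulus γ H δ (ξ₀ s) ‖p.1 - p.2‖)
    ((isCompact_closedBall (0 : Plane) (R + δ)).prod (isCompact_closedBall (0 : Plane) (R + δ)))
    (continuousOn_sub_evtModulus hδ (h.continuousOn hm hc) (hcont.mono hsub)
      (fun s hs => hpos s (hsub hs)) hle) ?_ ?_ ?_ t htt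
  · intro x y _
    have h1 := hmain (x, y)
    have h2 := hmain (y, x)
    simp only at h1 h2
    rw [norm_sub_rev] at h2
    rw [abs_lt]
    constructor <;> linarith
  · rintro s hs ⟨x, y⟩ hxy
    simp only at hxy
    have h1 := hnear s hs x y hxy
    have h2 := hlow s hs ‖x - y‖ (norm_nonneg _)
    have h3 : ‖x‖ ≤ R ∨ ‖y‖ ≤ R := by
      by_contra! hcon
      have h4 := (abs_lt.1 (hR s hs x hcon.1)).2
      have h5 := (abs_lt.1 (hR s hs y hcon.2)).1
      linarith
    have h4 := norm_le_norm_add_norm_sub' x y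
    have h5 := norm_le_norm_add_norm_sub x y
    rw [mem_prod, mem_closedBall_zero_iff, mem_closedBall_zero_iff]
    rcases h3 with h3 | h3 <;> constructor <;> linarith
  · rintro ⟨x, y⟩
    have h0 : (0 : ℝ) ∈ Icc 0 t := ⟨le_rfl, ht.1⟩
    simp only
    rw [h.initial]
    rcases eq_or_ne x y with rfl | hxy
    · have h1 := hlow 0 h0 ‖x - x‖ (norm_nonneg _)
      linarith
    · have h1 := hobey x y hxy
      rw [hξ0]
      linarith [le_abs_self (θ₀ x - θ₀ y)]
  · rintro s hs ⟨x, y⟩ hxy hmax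
    have hs' : s ∈ Icc 0 t := ⟨hs.1.le, hs.2⟩
    have hsT := hsub hs'
    simp only at hxy hmax ⊢
    have hne : x ≠ y := by
      rintro rfl
      have h1 := hlow s hs' ‖x - x‖ (norm_nonneg _)
      linarith
    have hss : Icc 0 s ⊆ Ico 0 T := fun u hu => hsub ⟨hu.1, hu.2.trans hs.2⟩
    exact exists_neg_hasDerivWithinAt_of_touching h hα hα1 hαβ hβ2 hν hε hm hc hγ hγ1 hαγ hH hδ
      hHδ hC₂ hC₂0 hs.1 (fun u hu => hpos u (hss hu)) (fun u hu => hanti (hss hu) hsT hu.2)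
      (hle s hs') ((hξ₀ s hsT).hasDerivAt (Ico_mem_nhds hs.1 hsT.2)) hne
      (hnear s hs' x y hxy.ge).le (by linarith) (fun x' y' => by linarith [hmax (x', y')])

theorem lemma5p4 (β γ ν : ℝ) (hν : 0 < ν) :
    ∃ C₂ : ℝ, 0 < C₂ ∧
      ∀ α : ℝ, 0 < α → α < 1 → 2 * α < β → β ≤ α + 1 →
        max (α + 1 - β) (α / 2) < γ → γ < 1 →
      ∃ C₁ : ℝ, 0 < C₁ ∧
        ∀ (ε m c₁ H δ : ℝ) (θ₀ : Plane → ℝ) (θ : ℝ → Plane → ℝ),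
          0 < ε → 2 < m → 0 < c₁ → c₁ ≤ 1 / 2 → 0 < H → 0 < δ →
          Continuous θ₀ → MemH m θ₀ →
          IsGlobalSmoothSolution α β ν ε m θ₀ θ →
          ENNReal.ofReal (2 * (1 + c₁)) * eLpNorm θ₀ ∞ volume ≤ ENNReal.ofReal H →
          ObeysModulus θ₀ (evtModulus γ H δ δ) →
          H ≤ C₁ * δ ^ (α + 1 - β) →
          ∀ (T : ℝ) (ξ₀ : ℝ → ℝ),
            ξ₀ 0 = δ →
            (∀ t ∈ Ico 0 T, 0 < ξ₀ t) →
            (∀ t ∈ Ico 0 T,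
              HasDerivWithinAt ξ₀ (-C₂ * ξ₀ t ^ (1 - β)) (Ico 0 T) t) →
            ∀ t ∈ Ico 0 T, ObeysModulus (θ t) (evtModulus γ H δ (ξ₀ t)) := by
  -- `C₂` is chosen before `α`; if these conditions fail, no `α` is admissible and any constant will
  -- do.
  by_cases hadm : (0 < β ∧ β < 2) ∧ 0 < γ
  swap
  · refine ⟨1, one_pos, fun α hα hα1 hαβ hβα hγ _ => absurd ?_ hadm⟩
    have h1 : α / 2 < γ := (le_max_right _ _).trans_lt hγ
    exact ⟨⟨by linarith, by linarith⟩, by linarith⟩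
  obtain ⟨⟨hβ, hβ2⟩, hγ⟩ := hadm
  have hF := fracConst_pos hβ hβ2
  have hk := dissConst_pos β
  -- Half of the critical value, so that the comparison with the remaining dissipation is strict.
  refine ⟨ν / (4 * fracConst β) * dissConst β / γ, by positivity,
    fun α hα hα1 hαβ hβα hmax hγ1 => ?_⟩
  have hαγ : α + 1 - β < γ := (le_max_left _ _).trans_lt hmax
  have hN := nonlinConst_pos (β := β) hα hα1 hγ hγ1
  refine ⟨ν / (2 * fracConst β) / nonlinConst α β γ, by positivity, ?_⟩
  intro ε m c₁ H δ θ₀ θ hε hm hc₁ _ hH hδ hc _ h hnorm hobey hHδ T ξ₀ hξ0 hpos hξ₀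
  have hM := abs_le_of_eLpNorm_top_le hc (by linarith : 0 < 2 * (1 + c₁)) hH.le hnorm
  refine obeysModulus_of_constants h hα hα1 (by linarith) hβ2 hν hε hm hc hγ hγ1 hαγ hH hδ ?_ ?_
    (by positivity) hM ?_ hobey hξ0 hpos hξ₀
  · have h1 := mul_le_mul_of_nonneg_right hHδ hN.le
    refine h1.trans (le_of_eq ?_)
    field_simp
  · rw [div_mul_cancel₀ _ hγ.ne']
    gcongr
    norm_num
  -- Twice the sup bound is `H / (1 + c₁)`, which is strictly below `H` because `c₁ > 0`.
  · rw [← mul_div_assoc, mul_div_mul_left _ _ two_ne_zero, div_lt_iff₀ (by linarith)]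
    nlinarith
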